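/- **Setting.** Let $G=(C,S,E)$ be a bipartite graph with $n$ candidates $C$, $\ell$ positions $S$ and $m=|E|$ edges that has a matching of cardinality $\ell$. Let $\mathcal M$ be the set of its maximum matchings. For $M\in\mathcal M$ let $e(M,j)$ be its edge at position $j$. Write $s(e)$ for the position of $e$, $E_j$ for the set of edges at position $j$, and $K=\sum_j |E_j|(|E_j|-1)/2$. For edges $e,e'$ at the same position, $p_{e,e'}\in[0,1]$, with $p_{e,e'}=1-p_{e',e}$, is the unknown probability that $e$ wins a duel against $e'$. Put $$B(M)=\frac1{|\mathcal M|}\sum_{M'\in\mathcal M}\frac1\ell\sum_{j=1}^{\ell}p_{e(M,j),e(M',j)},\qquad w(e)=\frac1{|\mathcal M|}\sum_{M\in\mathcal M}p_{e,e(M,s(e))},\qquad w(M)=\sum_{e\in M}w(e),$$ and assume that $B$ has a unique maximizer $M^B_*$ on $\mathcal M$. Let $\mathrm{width}(G)$ be the maximum, over distinct $M_1,M_2\in\mathcal M$, of the largest number of edges of a connected component of $M_1\cup M_2$. Let $\Delta^B_e=w(M^B_*)-\max\{w(M):M\in\mathcal M,\,e\in M\}$ if $e\notin M^B_*$ and $\Delta^B_e=w(M^B_*)-\max\{w(M):M\in\mathcal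 M,\,e\notin M\}$ if $e\in M^B_*$, where the maximum of the empty set is $-\infty$. Finally let $$H^B_\varepsilon=\sum_{e\in E}\min\Big\{\frac{\mathrm{width}(G)^2}{(\Delta^B_e)^2},\frac1{\varepsilon^2}\Big\}$$ (terms with $\Delta^B_e=+\infty$ are $0$, and $0\ln 0=0$). **Sampler.** An almost uniform sampler $\mathcal S(\eta)$ returns, for a bipartite graph that has a perfect matching and for $\eta>0$, a random perfect matching whose law is within total variation distance $\eta$ of the uniform law. To sample $M'\in\mathcal M$, add $n-\ell$ fictitious positions to $G$, each joined to all candidates, call $\mathcal S(\eta)$ on the result, and delete the fictitious edges. **Algorithm (CLUCB-Borda-PAC).** The input is $\delta\in(0,1)$, $\varepsilon\in(0,1]$, $G$, $\mathcal S$, and an oracle $\mathrm{MWMC}$ that returns for any edge weights some $M\in\mathcal M$ of maximum weight. Put $\eta=\varepsilon/8$. Start with $T_1(e)=0$ and $\bar w_1(e)=0$ for all $e$. In round $t=1,2,\dots$: 1. Let $M_t=\mathrm{MWMC}(\bar w_t)$ and $c_t(e)=\sqrt{\ln(4Kt^3/\delta)/(2T_t(e))}$ (with $x/0:=1$). Let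 $\tilde w_t(e)=\bar w_t(e)-c_t(e)-\varepsilon/4$ for $e\in M_t$ and $\tilde w_t(e)=\bar w_t(e)+c_t(e)+\varepsilon/4$ for $e\notin M_t$. Let $\tilde M_t=\mathrm{MWMC}(\tilde w_t)$. 2. If $\tilde w_t(\tilde M_t)-\tilde w_t(M_t)\le\ell\varepsilon$, stop and return $\mathsf{Out}=M_t$. 3. Otherwise let $z_t$ maximize $c_t$ over the symmetric difference of $M_t$ and $\tilde M_t$, sample a fresh $M'$ with $\mathcal S(\eta)$, and play the duel of $z_t$ against $e(M',s(z_t))$. Its outcome $X_t$ is $1$ if $z_t$ wins and $0$ otherwise. Set $T_{t+1}(z_t)=T_t(z_t)+1$ and $\bar w_{t+1}(z_t)=\big(\bar w_t(z_t)T_t(z_t)+X_t\big)/\big(T_t(z_t)+1\big)$, and leave the other entries unchanged. All ties are broken arbitrarily. **Theorem.** There is a universal constant $C>0$ such that for every such instance, all $\delta\in(0,1)$ and $\varepsilon\in(0,1]$, every almost uniform sampler, every oracle and every tie-breaking rule, the following hold simultaneously with probability at least $1-\delta$: CLUCB-Borda-PAC stops, its output satisfies $$B(\mathsf{Out})\ge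 B(M^B_*)-\varepsilon,$$ and the number $T$ of duels it has sampled satisfies $$T\le C\Big(H^B_\varepsilon\ln\frac{H^B_\varepsilon}{\delta}+m\Big);$$ moreover, if every edge of $G$ belongs to at least one maximum matching, then $$T\le C\,H^B_\varepsilon\ln\frac{H^B_\varepsilon}{\delta}.$$ -/

import Mathlib

open scoped ENNReal NNReal

namespace BordaDuel

/-! ### Bipartite graphs and matchings -/

/-- A bipartite graph with candidates `Fin n` and positions `Fin ℓ`, given by its set of edges
`(candidate, position)`. -/
abbrev BipGraph (n ℓ : ℕ) := Finset (Fin n × Fin ℓ)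

/-- The edges of `G`. -/
abbrev Edge {n ℓ : ℕ} (G : BipGraph n ℓ) := {e : Fin n × Fin ℓ // e ∈ G}

section Graph

variable {n ℓ : ℕ} {G : BipGraph n ℓ}

/-- The candidate of an edge. -/
def cand (e : Edge G) : Fin n := e.1.1

/-- The position `s(e)` of an edge. -/
def pos (e : Edge G) : Fin ℓ := e.1.2

/-- No two distinct edges of `M` share a candidate or a position. -/
def IsMatching (M : Finset (Edge G)) : Prop :=
  ∀ e ∈ M, ∀ e' ∈ M, e ≠ e' → cand e ≠ cand e' ∧ pos e ≠ pos e'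

/-- A matching of maximum cardinality. -/
def IsMaxMatching (M : Finset (Edge G)) : Prop :=
  IsMatching M ∧ ∀ M' : Finset (Edge G), IsMatching M' → M'.card ≤ M.card

/-- A matching that covers every vertex. -/
def IsPerfectMatching (M : Finset (Edge G)) : Prop :=
  IsMatching M ∧ (∀ c : Fin n, ∃ e ∈ M, cand e = c) ∧ (∀ j : Fin ℓ, ∃ e ∈ M, pos e = j)

/-- The decision class: all maximum matchings of `G`. -/
abbrev MaxMatching (G : BipGraph n ℓ) := {M : Finset (Edge G) // IsMaxMatching M}

/-- All perfect matchings of `G`. -/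
abbrev PerfectMatching (G : BipGraph n ℓ) := {M : Finset (Edge G) // IsPerfectMatching M}

noncomputable instance : Fintype (MaxMatching G) := Fintype.ofFinite _

noncomputable instance : Fintype (PerfectMatching G) := Fintype.ofFinite _

/-- The union graph of two sets of edges, on the vertex set candidates ⊕ positions. -/
def unionGraph (M₁ M₂ : Finset (Edge G)) : SimpleGraph (Fin n ⊕ Fin ℓ) :=
  SimpleGraph.fromEdgeSet {x | ∃ e ∈ M₁ ∪ M₂, x = s(Sum.inl (cand e), Sum.inr (pos e))}

open Classical in
/-- The number of edges of the union graph that lie in the connected component of the edge `e`. -/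
noncomputable def componentSize (M₁ M₂ : Finset (Edge G)) (e : Edge G) : ℕ :=
  ((M₁ ∪ M₂).filter fun e' =>
    (unionGraph M₁ M₂).Reachable (Sum.inl (cand e)) (Sum.inl (cand e'))).card

/-- The largest number of edges of a connected component of the union graph. -/
noncomputable def pairWidth (M₁ M₂ : Finset (Edge G)) : ℕ :=
  (M₁ ∪ M₂).sup (componentSize M₁ M₂)

open Classical in
/-- The width of `G`: the largest `pairWidth` of two distinct maximum matchings. -/
noncomputable def width (G : BipGraph n ℓ) : ℕ :=
  ((Finset.univ : Finset (MaxMatching G × MaxMatching G)).filter fun q => q.1 ≠ q.2).sup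
    fun q => pairWidth q.1.1 q.2.1

/-- The number of possible duels between two comparable edges, `∑ⱼ |Eⱼ| (|Eⱼ| - 1) / 2`. -/
noncomputable def numDuels (G : BipGraph n ℓ) : ℝ :=
  ∑ j : Fin ℓ, ((Finset.univ.filter fun e : Edge G => pos e = j).card : ℝ) *
    (((Finset.univ.filter fun e : Edge G => pos e = j).card : ℝ) - 1) / 2

/-- The balanced graph obtained from `G` (when `ℓ ≤ n`) by adding the fictitious positions
`ℓ, …, n - 1`, each of them joined to every candidate. -/
def augment (G : BipGraph n ℓ) : BipGraph n n :=
  Finset.univ.filter fun q => ∀ h : q.2.1 < ℓ, (q.1, (⟨q.2.1, h⟩ : Fin ℓ)) ∈ G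

/-- Eliminate the fictitious edges of a set of edges of `augment G`. -/
def eliminate (M : Finset (Edge (augment G))) : Finset (Edge G) :=
  Finset.univ.filter fun e => ∃ e' ∈ M, cand e' = cand e ∧ (pos e').1 = (pos e).1

theorem IsMatching.card_le {M : Finset (Edge G)} (hM : IsMatching M) : M.card ≤ ℓ := by
  have h : Set.InjOn (pos : Edge G → Fin ℓ) M := by
    intro e he e' he' hee
    by_contra hne
    exact (hM e he e' he' hne).2 hee
  simpa using Finset.card_le_card_of_injOn (t := Finset.univ) pos (by simp) h

theorem IsMatching.exists_pos {M : Finset (Edge G)} (hM : IsMatching M) (hc : ℓ ≤ M.card)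
    (j : Fin ℓ) : ∃ e ∈ M, pos e = j := by
  have h : Set.InjOn (pos : Edge G → Fin ℓ) M := by
    intro e he e' he' hee
    by_contra hne
    exact (hM e he e' he' hne).2 hee
  have h2 : M.image pos = Finset.univ := by
    apply Finset.eq_univ_of_card
    rw [Finset.card_image_of_injOn h, Fintype.card_fin]
    exact le_antisymm hM.card_le hc
  have h3 : j ∈ M.image pos := by rw [h2]; exact Finset.mem_univ j
  simpa using h3

theorem isMaxMatching_eliminate {M : Finset (Edge (augment G))} (hn : ℓ ≤ n)
    (hM : IsPerfectMatching M) : IsMaxMatching (eliminate M) := by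
  have key : IsMatching (eliminate M) := by
    intro e he e' he' hne
    simp only [eliminate, Finset.mem_filter, Finset.mem_univ, true_and] at he he'
    obtain ⟨f, hf, hfc, hfp⟩ := he
    obtain ⟨f', hf', hfc', hfp'⟩ := he'
    have hff : f ≠ f' := by
      rintro rfl
      apply hne
      apply Subtype.ext
      exact Prod.ext (hfc.symm.trans hfc') (Fin.ext (hfp.symm.trans hfp'))
    obtain ⟨h1, h2⟩ := hM.1 f hf f' hf' hff
    refine ⟨fun h => h1 (hfc.trans (h.trans hfc'.symm)), fun h => h2 (Fin.ext ?_)⟩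
    rw [hfp, hfp', h]
  refine ⟨key, fun M' hM' => hM'.card_le.trans ?_⟩
  have hsurj : (Finset.univ : Finset (Fin ℓ)) ⊆ (eliminate M).image pos := by
    intro j _
    obtain ⟨f, hf, hfp⟩ := hM.2.2 (Fin.castLE hn j)
    have hv : (pos f).1 = j.1 := by rw [hfp]; rfl
    have hlt : f.1.2.1 < ℓ := by
      change (pos f).1 < ℓ
      rw [hv]; exact j.2
    have hmem := (Finset.mem_filter.1 f.2).2 hlt
    refine Finset.mem_image.2 ⟨⟨_, hmem⟩, ?_, Fin.ext hv⟩
    simp only [eliminate, Finset.mem_filter, Finset.mem_univ, true_and]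
    exact ⟨f, hf, rfl, rfl⟩
  calc ℓ = (Finset.univ : Finset (Fin ℓ)).card := by simp
    _ ≤ _ := Finset.card_le_card hsurj
    _ ≤ _ := Finset.card_image_le

end Graph

/-! ### Duel instances, Borda scores and hardness -/

/-- An instance of combinatorial pure exploration for dueling bandits: a bipartite graph that has a
matching covering every position, and the (unknown) preference matrix of its edges. Note that
`p_compl` contains `p e e = 1 / 2`. -/
structure Instance (n ℓ : ℕ) where
  /-- the bipartite graph -/
  G : BipGraph n ℓ
  exists_matching : ∃ M : Finset (Edge G), IsMatching M ∧ M.card = ℓ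
  /-- `p e e'` is the probability that `e` wins the duel against `e'` -/
  p : Edge G → Edge G → ℝ
  p_nonneg : ∀ e e', 0 ≤ p e e'
  p_le_one : ∀ e e', p e e' ≤ 1
  p_compl : ∀ e e', pos e = pos e' → p e e' = 1 - p e' e
  p_incomparable : ∀ e e', pos e ≠ pos e' → p e e' = 0

namespace Instance

variable {n ℓ : ℕ} (I : Instance n ℓ)

theorem le_card (M : MaxMatching I.G) : ℓ ≤ M.1.card := by
  obtain ⟨M', hM', hc⟩ := I.exists_matching
  exact hc.ge.trans (M.2.2 M' hM')

/-- The edge `e(M, j)` of the maximum matching `M` at the position `j`. -/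
noncomputable def edgeAt (M : MaxMatching I.G) (j : Fin ℓ) : Edge I.G :=
  (M.2.1.exists_pos (I.le_card M) j).choose

theorem edgeAt_mem (M : MaxMatching I.G) (j : Fin ℓ) : I.edgeAt M j ∈ M.1 :=
  (M.2.1.exists_pos (I.le_card M) j).choose_spec.1

theorem pos_edgeAt (M : MaxMatching I.G) (j : Fin ℓ) : pos (I.edgeAt M j) = j :=
  (M.2.1.exists_pos (I.le_card M) j).choose_spec.2

/-- The preference probability `f(M₁, M₂, P)` of `M₁` over `M₂`. -/
noncomputable def pref (M₁ M₂ : MaxMatching I.G) : ℝ :=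
  (1 / (ℓ : ℝ)) * ∑ j : Fin ℓ, I.p (I.edgeAt M₁ j) (I.edgeAt M₂ j)

/-- The Borda score `B(M)`. -/
noncomputable def borda (M : MaxMatching I.G) : ℝ :=
  (1 / (Fintype.card (MaxMatching I.G) : ℝ)) * ∑ M' : MaxMatching I.G, I.pref M M'

/-- The reward `w(e)` of an edge. -/
noncomputable def edgeReward (e : Edge I.G) : ℝ :=
  (1 / (Fintype.card (MaxMatching I.G) : ℝ)) *
    ∑ M : MaxMatching I.G, I.p e (I.edgeAt M (pos e))

/-- The reward `w(M)` of a matching. -/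
noncomputable def reward (M : MaxMatching I.G) : ℝ := ∑ e ∈ M.1, I.edgeReward e

/-- `Mstar` is the unique Borda winner. -/
def IsBordaWinner (Mstar : MaxMatching I.G) : Prop :=
  ∀ M : MaxMatching I.G, M ≠ Mstar → I.borda M < I.borda Mstar

open Classical in
/-- The Borda gap of the edge `e`, with the convention that the maximum of the empty set is
`-∞` (so that the gap is then `+∞`). -/
noncomputable def bordaGap (Mstar : MaxMatching I.G) (e : Edge I.G) : EReal :=
  (I.reward Mstar : EReal) -
    (if e ∈ Mstar.1 then
      (Finset.univ.filter fun M : MaxMatching I.G => e ∉ M.1).sup fun M => (I.reward M : EReal)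
    else
      (Finset.univ.filter fun M : MaxMatching I.G => e ∈ M.1).sup fun M => (I.reward M : EReal))

/-- The hardness `∑ₑ min (width(G)² / gap(e)², 1 / ε²)`; a term with `gap(e) = +∞` is `0`. -/
noncomputable def hardness (Mstar : MaxMatching I.G) (ε : ℝ) : ℝ :=
  ∑ e : Edge I.G,
    (min (((width I.G : ℝ) : EReal) ^ 2 / I.bordaGap Mstar e ^ 2)
      ((1 / ε ^ 2 : ℝ) : EReal)).toReal

theorem exists_cand :
    ∃ c : Fin ℓ → Fin n, Function.Injective c ∧ ∀ j, (c j, j) ∈ I.G := by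
  obtain ⟨M, hM, hc⟩ := I.exists_matching
  choose f hf hp using fun j => hM.exists_pos hc.ge j
  refine ⟨fun j => cand (f j), fun i j hij => ?_, fun j => ?_⟩
  · by_contra hne
    have hfne : f i ≠ f j := fun h => hne (by rw [← hp i, ← hp j, h])
    exact (hM _ (hf i) _ (hf j) hfne).1 hij
  · have h : (cand (f j), j) = (f j).1 := Prod.ext rfl (hp j).symm
    rw [h]
    exact (f j).2

theorem le_cands (I : Instance n ℓ) : ℓ ≤ n := by
  obtain ⟨c, hc, -⟩ := I.exists_cand
  simpa using Fintype.card_le_of_injective c hc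

theorem nonempty_perfect : Nonempty (PerfectMatching (augment I.G)) := by
  obtain ⟨c, hc, hG⟩ := I.exists_cand
  obtain ⟨σ, hσ⟩ := Equiv.Perm.exists_extending_pair (Fin.castLE I.le_cands) c
    (Fin.castLE_injective _) hc
  have hmem : ∀ i : Fin n, (σ i, i) ∈ augment I.G := by
    intro i
    refine Finset.mem_filter.2 ⟨Finset.mem_univ _, fun h => ?_⟩
    have h1 : σ i = c ⟨i.1, h⟩ := by
      rw [← hσ]; rfl
    change (σ i, (⟨i.1, h⟩ : Fin ℓ)) ∈ I.G
    rw [h1]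
    exact hG _
  refine ⟨⟨Finset.univ.image fun i => (⟨(σ i, i), hmem i⟩ : Edge (augment I.G)), ?_, ?_, ?_⟩⟩
  · intro e he e' he' hne
    obtain ⟨i, -, rfl⟩ := Finset.mem_image.1 he
    obtain ⟨i', -, rfl⟩ := Finset.mem_image.1 he'
    have hi : i ≠ i' := by rintro rfl; exact hne rfl
    exact ⟨fun h => hi (σ.injective h), hi⟩
  · intro x
    exact ⟨_, Finset.mem_image.2 ⟨σ.symm x, Finset.mem_univ _, rfl⟩, σ.apply_symm_apply x⟩
  · intro j
    exact ⟨_, Finset.mem_image.2 ⟨j, Finset.mem_univ _, rfl⟩, rfl⟩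

end Instance

/-! ### The subroutines of the algorithm -/

/-- An almost uniform sampler for perfect matchings: given a bipartite graph with a perfect matching
and a bias parameter `η > 0`, it returns a random perfect matching whose law is within total
variation distance `η` of the uniform distribution. -/
structure AlmostUniformSampler where
  /-- the law of the returned perfect matching -/
  law : ∀ {k : ℕ} (H : BipGraph k k), Nonempty (PerfectMatching H) → ℝ → PMF (PerfectMatching H)
  tv_le : ∀ {k : ℕ} (H : BipGraph k k) (hH : Nonempty (PerfectMatching H)) (η : ℝ), 0 < η →
    (1 / 2 : ℝ) * ∑ x : PerfectMatching H,
      |(law H hH η x).toReal - 1 / (Fintype.card (PerfectMatching H) : ℝ)| ≤ η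

/-- A maximum-weighted maximum-cardinality matching oracle for `G` (with arbitrary tie-breaking). -/
structure MWMC {n ℓ : ℕ} (G : BipGraph n ℓ) where
  /-- the returned matching -/
  out : (Edge G → ℝ) → MaxMatching G
  out_max : ∀ (v : Edge G → ℝ) (M : MaxMatching G), ∑ e ∈ M.1, v e ≤ ∑ e ∈ (out v).1, v e

/-- A rule that selects a maximizer of a function over a nonempty finite set of edges (with
arbitrary tie-breaking). -/
structure ArgMax {n ℓ : ℕ} (G : BipGraph n ℓ) where
  /-- the selected edge -/
  sel : (Edge G → ℝ) → (D : Finset (Edge G)) → D.Nonempty → Edge G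
  sel_mem : ∀ (v : Edge G → ℝ) (D : Finset (Edge G)) (hD : D.Nonempty), sel v D hD ∈ D
  sel_max : ∀ (v : Edge G → ℝ) (D : Finset (Edge G)) (hD : D.Nonempty), ∀ e ∈ D, v e ≤ v (sel v D hD)

/-! ### The algorithm CLUCB-Borda-PAC -/

/-- A configuration of the algorithm. Either it is at the start of round `t` with pull counts `T`
and empirical means `wbar`, or it has returned the matching `out` after `samples` duels. -/
inductive Config {n ℓ : ℕ} (G : BipGraph n ℓ) where
  | running (t : ℕ) (T : Edge G → ℕ) (wbar : Edge G → ℝ)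
  | returned (out : MaxMatching G) (samples : ℕ)

namespace Instance

variable {n ℓ : ℕ} (I : Instance n ℓ)

/-- The law of the outcome of a duel between `e` and `e'` (`true` when `e` wins). -/
noncomputable def duel (e e' : Edge I.G) : PMF Bool :=
  PMF.ofFintype
    (fun b => if b then ENNReal.ofReal (I.p e e') else ENNReal.ofReal (1 - I.p e e')) (by
      have h1 : 0 ≤ 1 - I.p e e' := sub_nonneg.2 (I.p_le_one e e')
      simp [← ENNReal.ofReal_add (I.p_nonneg e e') h1])

/-- The law of a maximum matching of `G` that is sampled with bias parameter `η`: sample a perfect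
matching of the augmented graph and eliminate its fictitious edges. -/
noncomputable def sampleMatching (S : AlmostUniformSampler) (η : ℝ) : PMF (MaxMatching I.G) :=
  (S.law (augment I.G) I.nonempty_perfect η).map fun M =>
    ⟨eliminate M.1, isMaxMatching_eliminate I.le_cands M.2⟩

/-- The confidence radius `c_t(e)`, with the convention `x / 0 = 1` when `e` was never pulled. -/
noncomputable def radius (δ : ℝ) (t : ℕ) (T : Edge I.G → ℕ) (e : Edge I.G) : ℝ :=
  √(if T e = 0 then 1
    else Real.log (4 * numDuels I.G * (t : ℝ) ^ 3 / δ) / (2 * (T e : ℝ)))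

/-- The adjusted weights `w̃_t`. -/
noncomputable def adjusted (δ ε : ℝ) (t : ℕ) (T : Edge I.G → ℕ) (wbar : Edge I.G → ℝ)
    (M : MaxMatching I.G) (e : Edge I.G) : ℝ :=
  if e ∈ M.1 then wbar e - I.radius δ t T e - ε / 4 else wbar e + I.radius δ t T e + ε / 4

/-- The round that starts in the given configuration. The last branch (no stop, but the two
matchings coincide) is never taken when `0 ≤ ε`. -/
noncomputable def step (S : AlmostUniformSampler) (O : MWMC I.G) (A : ArgMax I.G) (δ ε : ℝ) :
    Config I.G → PMF (Config I.G)
  | .returned out k => PMF.pure (.returned out k)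
  | .running t T wbar =>
    let M := O.out wbar
    let wt := I.adjusted δ ε t T wbar M
    let M' := O.out wt
    let D := (M'.1 \ M.1) ∪ (M.1 \ M'.1)
    if ∑ e ∈ M'.1, wt e - ∑ e ∈ M.1, wt e ≤ ℓ * ε then
      PMF.pure (.returned M (∑ e, T e))
    else if hD : D.Nonempty then
      let z := A.sel (I.radius δ t T) D hD
      (I.sampleMatching S (ε / 8)).bind fun N =>
        (I.duel z (I.edgeAt N (pos z))).map fun X =>
          .running (t + 1) (Function.update T z (T z + 1))
            (Function.update wbar z ((wbar z * T z + if X then 1 else 0) / (T z + 1)))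
    else PMF.pure (.returned M (∑ e, T e))

/-- The law of the configuration after `k` rounds, from `t = 1`, `T = 0`, `wbar = 0`. -/
noncomputable def configLaw (S : AlmostUniformSampler) (O : MWMC I.G) (A : ArgMax I.G) (δ ε : ℝ) :
    ℕ → PMF (Config I.G)
  | 0 => PMF.pure (.running 1 (fun _ => 0) (fun _ => 0))
  | k + 1 => (configLaw S O A δ ε k).bind (I.step S O A δ ε)

/-- The probability that the algorithm halts with an output and a number of samples that satisfy
`Q`. Returned configurations are absorbing, so this is the limit of a nondecreasing sequence. -/
noncomputable def haltProb (S : AlmostUniformSampler) (O : MWMC I.G) (A : ArgMax I.G) (δ ε : ℝ)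
    (Q : MaxMatching I.G → ℕ → Prop) : ℝ≥0∞ :=
  ⨆ k : ℕ, (I.configLaw S O A δ ε k).toOuterMeasure
    {s | ∃ out samples, s = .returned out samples ∧ Q out samples}

end Instance

end BordaDuel

namespace BordaDuel

namespace Instance

variable {n ℓ : ℕ} (I : Instance n ℓ)

/-! ### Maximum matchings as functions of the position -/

/-! The Borda score is the linear objective `reward` divided by `ℓ` (`borda_eq`), so the task is
best-matching identification with noisy edge weights. A duel of `e` against a sampled matching is a
coin of bias `winProb`. Deleting fictitious edges sends the uniform law on perfect matchings to the
uniform law on maximum matchings (`average_eliminated`), hence a sampler of bias `ε / 8` moves this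
coin by at most `ε / 4` from `edgeReward` (`abs_winProb_sub_le`). This is the slack `ε / 4` that the
adjusted weights add to the radius.

Suppose that in every round all active edges have weights within radius plus slack. Stopping is then
safe, since the adjusted weights overestimate what any other matching gains over the current one
(`reward_sub_le_pessimistic`). A round that does not stop plays an edge `z` of radius `r` with `ε <
4 * r`, and an exchange argument on connected components (`exists_exchange`, `gap_le_of_mem_diff`)
bounds the gap of `z` by `6 * r * width`. Since `r ^ 2` is a logarithm over twice the pull count,
`z` has been pulled at most `18 * hardnessTerm * logTerm` times (`pulls_le_of_pulled`). Summing over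
active edges bounds the number of rounds implicitly, as it also occurs in the logarithm; the last
lemmas solve this inequality.

The confidence events fail with total probability at most `δ`: an exponential supermartingale gives
a Chernoff bound for each edge and each pull count, and a union bound leaves a telescoping series in
the round (`unconfident_le`, `not_good_le`). The induction runs on the laws `configLaw`, so no
measure on trajectories is needed. -/

theorem mem_iff_edgeAt_eq (M : MaxMatching I.G) (e : Edge I.G) :
    e ∈ M.1 ↔ I.edgeAt M (pos e) = e := by
  refine ⟨fun he => ?_, fun h => h ▸ I.edgeAt_mem M _⟩
  by_contra hne
  exact (M.2.1 _ (I.edgeAt_mem M (pos e)) e he hne).2 (I.pos_edgeAt M _)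

theorem edgeAt_injective (M : MaxMatching I.G) : Function.Injective (I.edgeAt M) := fun i j h => by
  rw [← I.pos_edgeAt M i, h, I.pos_edgeAt]

theorem cand_edgeAt_injective (M : MaxMatching I.G) :
    Function.Injective fun j => cand (I.edgeAt M j) := fun i j h => by
  by_contra hne
  exact (M.2.1 _ (I.edgeAt_mem M i) _ (I.edgeAt_mem M j)
    fun h' => hne (I.edgeAt_injective M h')).1 h

theorem val_eq_image (M : MaxMatching I.G) : M.1 = Finset.univ.image (I.edgeAt M) := by
  ext e
  rw [Finset.mem_image]
  constructor
  · intro he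
    exact ⟨pos e, Finset.mem_univ _, (I.mem_iff_edgeAt_eq M e).1 he⟩
  · rintro ⟨j, -, rfl⟩
    exact I.edgeAt_mem M j

theorem sum_matching (M : MaxMatching I.G) (v : Edge I.G → ℝ) :
    ∑ e ∈ M.1, v e = ∑ j, v (I.edgeAt M j) := by
  conv_lhs => rw [I.val_eq_image M]
  exact Finset.sum_image (I.edgeAt_injective M).injOn

theorem ext_edgeAt {M N : MaxMatching I.G} (h : ∀ j, I.edgeAt M j = I.edgeAt N j) : M = N := by
  apply Subtype.ext
  rw [I.val_eq_image M, I.val_eq_image N, funext h]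

/-- One edge per position already attains the cap `ℓ` on the size of a matching, so distinct
candidates are all that must be checked. Every exchanged matching is built this way. -/
theorem exists_matching_of_choice (f : Fin ℓ → Edge I.G) (hf : ∀ j, pos (f j) = j)
    (hc : Function.Injective fun j => cand (f j)) :
    ∃ M : MaxMatching I.G, ∀ j, I.edgeAt M j = f j := by
  have hinj : Function.Injective f := fun i j h => hc (congrArg cand h)
  have hmatch : IsMatching (Finset.univ.image f) := by
    intro e he e' he' hne
    obtain ⟨i, -, rfl⟩ := Finset.mem_image.1 he
    obtain ⟨j, -, rfl⟩ := Finset.mem_image.1 he'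
    have hij : i ≠ j := by rintro rfl; exact hne rfl
    exact ⟨fun h => hij (hc h), by rwa [hf, hf]⟩
  have hmax : IsMaxMatching (Finset.univ.image f) := by
    refine ⟨hmatch, fun M' hM' => ?_⟩
    rw [Finset.card_image_of_injective _ hinj, Finset.card_univ, Fintype.card_fin]
    exact hM'.card_le
  refine ⟨⟨_, hmax⟩, fun j => ?_⟩
  have := (I.mem_iff_edgeAt_eq ⟨_, hmax⟩ (f j)).1 (Finset.mem_image_of_mem f (Finset.mem_univ j))
  rwa [hf] at this

/-- Swapping the positions of a connected component of the union of two maximum matchings gives two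
maximum matchings, and at most `width G / 2` positions change. -/
theorem exists_exchange (M N : MaxMatching I.G) {i : Fin ℓ} (hi : I.edgeAt M i ≠ I.edgeAt N i) :
    ∃ J : Finset (Fin ℓ), i ∈ J ∧ (∀ j ∈ J, I.edgeAt M j ≠ I.edgeAt N j) ∧
      2 * J.card ≤ width I.G ∧
      (∃ M' : MaxMatching I.G, ∀ j, I.edgeAt M' j = if j ∈ J then I.edgeAt N j else I.edgeAt M j) ∧
      (∃ N' : MaxMatching I.G, ∀ j, I.edgeAt N' j = if j ∈ J then I.edgeAt M j else I.edgeAt N j) := by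
  classical
  set U := unionGraph M.1 N.1 with hU
  have hadj : ∀ e ∈ M.1 ∪ N.1, U.Adj (Sum.inl (cand e)) (Sum.inr (pos e)) := by
    intro e he
    rw [hU, unionGraph, SimpleGraph.fromEdgeSet_adj]
    exact ⟨⟨e, he, rfl⟩, by simp⟩
  have hM : ∀ j, U.Reachable (Sum.inl (cand (I.edgeAt M j))) (Sum.inr j) := fun j => by
    have := (hadj _ (Finset.mem_union_left _ (I.edgeAt_mem M j))).reachable
    rwa [I.pos_edgeAt] at this
  have hN : ∀ j, U.Reachable (Sum.inl (cand (I.edgeAt N j))) (Sum.inr j) := fun j => by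
    have := (hadj _ (Finset.mem_union_right _ (I.edgeAt_mem N j))).reachable
    rwa [I.pos_edgeAt] at this
  -- `R` is the component of `i`. In `J` the positions of agreement are dropped: swapping does
  -- nothing there, and the edges of `M` and `N` over `J` are then `2 * J.card` distinct edges of
  -- one component.
  set R : Fin ℓ → Prop := fun j => U.Reachable (Sum.inr i) (Sum.inr j) with hR
  set J : Finset (Fin ℓ) := Finset.univ.filter fun j => R j ∧ I.edgeAt M j ≠ I.edgeAt N j with hJ
  have hmemJ : ∀ j, j ∈ J ↔ R j ∧ I.edgeAt M j ≠ I.edgeAt N j := fun j => by simp [hJ]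
  -- A common candidate links its two positions, so an edge swapped in over the component cannot
  -- share a candidate with an edge kept outside it.
  have hlink : ∀ j k, cand (I.edgeAt M j) = cand (I.edgeAt N k) → (R j ↔ R k) := by
    intro j k h
    have h1 : U.Reachable (Sum.inr j) (Sum.inr k) := by
      refine (hM j).symm.trans ?_
      rw [h]
      exact hN k
    exact ⟨fun h => h.trans h1, fun h => h.trans h1.symm⟩
  have hswap : ∀ P Q : MaxMatching I.G,
      (∀ j k, cand (I.edgeAt P j) = cand (I.edgeAt Q k) → (R j ↔ R k)) →
      (∀ j, j ∈ J ↔ R j ∧ I.edgeAt P j ≠ I.edgeAt Q j) →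
      ∃ P' : MaxMatching I.G, ∀ j, I.edgeAt P' j = if j ∈ J then I.edgeAt Q j else I.edgeAt P j := by
    intro P Q hPQ hJPQ
    have hite : ∀ j, (if j ∈ J then I.edgeAt Q j else I.edgeAt P j) =
        if R j then I.edgeAt Q j else I.edgeAt P j := by
      intro j
      have hj := hJPQ j
      by_cases h1 : R j <;> by_cases h2 : I.edgeAt P j = I.edgeAt Q j <;>
        simp [hj, h1, h2]
    simp only [hite]
    refine I.exists_matching_of_choice _ (fun j => ?_) fun j k h => ?_
    · split_ifs <;> exact I.pos_edgeAt _ _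
    · by_cases h1 : R j <;> by_cases h2 : R k <;> simp only [h1, h2, if_true, if_false] at h
      · exact I.cand_edgeAt_injective Q h
      · exact absurd ((hPQ k j h.symm).2 h1) h2
      · exact absurd ((hPQ j k h).2 h2) h1
      · exact I.cand_edgeAt_injective P h
  refine ⟨J, (hmemJ i).2 ⟨SimpleGraph.Reachable.refl _, hi⟩, fun j hj => ((hmemJ j).1 hj).2, ?_,
    hswap M N hlink hmemJ, hswap N M (fun j k h => (hlink k j h.symm).symm) fun j => ?_⟩
  · have hne : M ≠ N := by rintro rfl; exact hi rfl
    have h1 : 2 * J.card = (J.image (I.edgeAt M) ∪ J.image (I.edgeAt N)).card := by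
      rw [Finset.card_union_of_disjoint, Finset.card_image_of_injective _ (I.edgeAt_injective M),
        Finset.card_image_of_injective _ (I.edgeAt_injective N), two_mul]
      rw [Finset.disjoint_left]
      intro e he he'
      obtain ⟨j, hj, rfl⟩ := Finset.mem_image.1 he
      obtain ⟨k, hk, hjk⟩ := Finset.mem_image.1 he'
      have : k = j := by rw [← I.pos_edgeAt N k, hjk, I.pos_edgeAt]
      subst this
      exact ((hmemJ k).1 hj).2 hjk.symm
    rw [h1]
    calc _ ≤ componentSize M.1 N.1 (I.edgeAt M i) := by
          unfold componentSize
          apply Finset.card_le_card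
          intro e he
          rw [Finset.mem_filter]
          rcases Finset.mem_union.1 he with he | he <;> obtain ⟨j, hj, rfl⟩ := Finset.mem_image.1 he
          · exact ⟨Finset.mem_union_left _ (I.edgeAt_mem M j),
              ((hM i).trans ((hmemJ j).1 hj).1).trans (hM j).symm⟩
          · exact ⟨Finset.mem_union_right _ (I.edgeAt_mem N j),
              ((hM i).trans ((hmemJ j).1 hj).1).trans (hN j).symm⟩
      _ ≤ pairWidth M.1 N.1 :=
          Finset.le_sup (f := componentSize M.1 N.1)
            (Finset.mem_union_left _ (I.edgeAt_mem M i))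
      _ ≤ width I.G :=
          Finset.le_sup (f := fun q : MaxMatching I.G × MaxMatching I.G => pairWidth q.1.1 q.2.1)
            (b := (M, N)) (Finset.mem_filter.2 ⟨Finset.mem_univ _, hne⟩)
  · rw [hmemJ, ne_comm]

/-- The edges that belong to some but not to all maximum matchings. -/
def IsActive (e : Edge I.G) : Prop :=
  (∃ M : MaxMatching I.G, e ∈ M.1) ∧ ∃ M : MaxMatching I.G, e ∉ M.1

theorem isActive_edgeAt {M N : MaxMatching I.G} {j : Fin ℓ} (h : I.edgeAt M j ≠ I.edgeAt N j) :
    I.IsActive (I.edgeAt M j) := by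
  refine ⟨⟨M, I.edgeAt_mem M j⟩, N, fun h' => h ?_⟩
  have := (I.mem_iff_edgeAt_eq N _).1 h'
  rw [I.pos_edgeAt] at this
  exact this.symm

open Classical in
/-- The set of active edges. -/
noncomputable def activeEdges : Finset (Edge I.G) := Finset.univ.filter I.IsActive

theorem mem_activeEdges {e : Edge I.G} : e ∈ I.activeEdges ↔ I.IsActive e := by
  simp [activeEdges]

theorem two_le_card_activeEdges {e : Edge I.G} (he : e ∈ I.activeEdges) :
    2 ≤ I.activeEdges.card := by
  obtain ⟨⟨M, hM⟩, N, hN⟩ := I.mem_activeEdges.1 he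
  rw [I.mem_iff_edgeAt_eq] at hM hN
  have hne : I.edgeAt M (pos e) ≠ I.edgeAt N (pos e) := fun h => hN (h ▸ hM)
  have := Finset.card_le_card (s := {I.edgeAt M (pos e), I.edgeAt N (pos e)}) (t := I.activeEdges)
    (by
      intro x hx
      rcases Finset.mem_insert.1 hx with rfl | hx
      · exact I.mem_activeEdges.2 (I.isActive_edgeAt hne)
      · rw [Finset.mem_singleton.1 hx]
        exact I.mem_activeEdges.2 (I.isActive_edgeAt hne.symm))
  rwa [Finset.card_pair hne] at this

/-! ### Counting the possible duels -/

theorem one_lt_card_pos_of_isActive {e : Edge I.G} (he : I.IsActive e) :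
    1 < (Finset.univ.filter fun e' : Edge I.G => pos e' = pos e).card := by
  obtain ⟨-, M, hM⟩ := he
  rw [Finset.one_lt_card]
  exact ⟨e, by simp, I.edgeAt M (pos e), by simp [I.pos_edgeAt],
    fun h => hM ((I.mem_iff_edgeAt_eq M e).2 h.symm)⟩

/-- A position with an active edge has at least two edges, and then `|Eⱼ| ≤ |Eⱼ| (|Eⱼ| - 1)`. This
lets the `numDuels` inside the radius pay for the union bound over edges. -/
theorem card_activeEdges_le : (I.activeEdges.card : ℝ) ≤ 2 * numDuels I.G := by
  have h : I.activeEdges.card =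
      ∑ j : Fin ℓ, (I.activeEdges.filter fun e => pos e = j).card :=
    Finset.card_eq_sum_card_fiberwise fun _ _ => Finset.mem_coe.2 (Finset.mem_univ _)
  rw [h, numDuels, Finset.mul_sum]
  push_cast
  refine Finset.sum_le_sum fun j _ => ?_
  set E := Finset.univ.filter fun e : Edge I.G => pos e = j with hE
  have hsub : (I.activeEdges.filter fun e => pos e = j) ⊆ E := fun e he => by
    simpa [hE] using (Finset.mem_filter.1 he).2
  have hle : ((I.activeEdges.filter fun e => pos e = j).card : ℝ) ≤ E.card := by
    exact_mod_cast Finset.card_le_card hsub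
  rcases (I.activeEdges.filter fun e => pos e = j).eq_empty_or_nonempty with h0 | ⟨e, he⟩
  · rw [h0]
    rcases Nat.eq_zero_or_pos E.card with h | h
    · rw [h]; norm_num
    · have : (1 : ℝ) ≤ E.card := by exact_mod_cast h
      have := sub_nonneg.2 this
      simp only [Finset.card_empty, Nat.cast_zero]
      positivity
  · have h1 := I.one_lt_card_pos_of_isActive (I.mem_activeEdges.1 (Finset.mem_filter.1 he).1)
    rw [(Finset.mem_filter.1 he).2] at h1
    have h2 : (2 : ℝ) ≤ E.card := by exact_mod_cast h1
    nlinarith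

/-- Positions with a single edge contribute nothing to `numDuels`; over the others, a sum of squares
is at most the square of the sum. -/
theorem numDuels_le_of_forall {D : Finset (Edge I.G)}
    (hD : ∀ e : Edge I.G, 1 < (Finset.univ.filter fun e' : Edge I.G => pos e' = pos e).card →
      e ∈ D) :
    2 * numDuels I.G ≤ (D.card : ℝ) ^ 2 := by
  have h : D.card = ∑ j : Fin ℓ, (D.filter fun e => pos e = j).card :=
    Finset.card_eq_sum_card_fiberwise fun _ _ => Finset.mem_coe.2 (Finset.mem_univ _)
  have h2 : ∑ j : Fin ℓ, ((D.filter fun e => pos e = j).card : ℝ) ^ 2 ≤ (D.card : ℝ) ^ 2 := by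
    rw [h]; push_cast
    exact Finset.sum_sq_le_sq_sum_of_nonneg fun _ _ => Nat.cast_nonneg _
  refine le_trans ?_ h2
  rw [numDuels, Finset.mul_sum]
  refine Finset.sum_le_sum fun j _ => ?_
  set E := Finset.univ.filter fun e : Edge I.G => pos e = j with hE
  rcases Nat.lt_or_ge 1 E.card with h1 | h1
  · have hsub : E ⊆ D.filter fun e => pos e = j := fun e he => by
      have hp : pos e = j := by simpa [hE] using he
      refine Finset.mem_filter.2 ⟨hD e ?_, hp⟩
      rw [hp]; exact h1
    have hle : (E.card : ℝ) ≤ (D.filter fun e => pos e = j).card := by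
      exact_mod_cast Finset.card_le_card hsub
    have h0 : (0 : ℝ) ≤ E.card := Nat.cast_nonneg _
    nlinarith
  · have h3 : (E.card : ℝ) ≤ 1 := by exact_mod_cast h1
    have h0 : (0 : ℝ) ≤ E.card := Nat.cast_nonneg _
    nlinarith [sq_nonneg ((D.filter fun e => pos e = j).card : ℝ)]

theorem two_mul_numDuels_le_card_sq : 2 * numDuels I.G ≤ (Fintype.card (Edge I.G) : ℝ) ^ 2 :=
  I.numDuels_le_of_forall (D := Finset.univ) fun _ _ => Finset.mem_univ _

/-- Two edges at one position exclude each other, so both are active once each lies in some maximum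
matching. As the hardness dominates the number of active edges, this is what removes the additive
`m` from the second bound. -/
theorem two_mul_numDuels_le_card_activeEdges_sq
    (h : ∀ e : Edge I.G, ∃ M : MaxMatching I.G, e ∈ M.1) :
    2 * numDuels I.G ≤ (I.activeEdges.card : ℝ) ^ 2 := by
  refine I.numDuels_le_of_forall fun e he => ?_
  obtain ⟨e', he', hne⟩ := Finset.exists_mem_ne he e
  obtain ⟨M, hM⟩ := h e'
  refine I.mem_activeEdges.2 ⟨h e, M, fun h' => hne ?_⟩
  rw [I.mem_iff_edgeAt_eq] at hM h'
  rw [← hM, ← h', (Finset.mem_filter.1 he').2]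

/-! ### Rewards and gaps -/

theorem nonempty_maxMatching : Nonempty (MaxMatching I.G) := by
  obtain ⟨M, hM, hc⟩ := I.exists_matching
  exact ⟨⟨M, hM, fun M' hM' => hM'.card_le.trans hc.ge⟩⟩

theorem card_maxMatching_pos : (0 : ℝ) < Fintype.card (MaxMatching I.G) := by
  have := I.nonempty_maxMatching
  exact_mod_cast Fintype.card_pos

theorem reward_eq (M : MaxMatching I.G) : I.reward M = ∑ j, I.edgeReward (I.edgeAt M j) :=
  I.sum_matching M _

theorem borda_eq (M : MaxMatching I.G) : I.borda M = (1 / (ℓ : ℝ)) * I.reward M := by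
  rw [reward_eq, borda]
  simp only [pref, edgeReward, I.pos_edgeAt, Finset.mul_sum]
  rw [Finset.sum_comm]
  exact Finset.sum_congr rfl fun _ _ => Finset.sum_congr rfl fun _ _ => by ring

theorem edgeReward_nonneg (e : Edge I.G) : 0 ≤ I.edgeReward e :=
  mul_nonneg (by positivity) (Finset.sum_nonneg fun _ _ => I.p_nonneg _ _)

theorem edgeReward_le_one (e : Edge I.G) : I.edgeReward e ≤ 1 := by
  have h := I.card_maxMatching_pos
  rw [edgeReward, one_div, inv_mul_le_iff₀ h, mul_one]
  calc _ ≤ ∑ _M : MaxMatching I.G, (1 : ℝ) := Finset.sum_le_sum fun _ _ => I.p_le_one _ _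
    _ = _ := by simp

theorem reward_lt_of_ne {Mstar : MaxMatching I.G} (hw : I.IsBordaWinner Mstar)
    {M : MaxMatching I.G} (hM : M ≠ Mstar) : I.reward M < I.reward Mstar := by
  have h := hw M hM
  rw [borda_eq, borda_eq] at h
  exact lt_of_mul_lt_mul_left h (by positivity)

theorem exists_gap {Mstar : MaxMatching I.G} (hw : I.IsBordaWinner Mstar) {e : Edge I.G}
    (he : I.IsActive e) :
    ∃ Δ : ℝ, 0 < Δ ∧ I.bordaGap Mstar e = (Δ : EReal) ∧
      ∀ M : MaxMatching I.G, (e ∈ M.1 ↔ e ∉ Mstar.1) → Δ ≤ I.reward Mstar - I.reward M := by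
  classical
  -- `W` covers both branches of the gap at once: the matchings that disagree with `Mstar` about
  -- `e`.
  set W : Finset (MaxMatching I.G) := Finset.univ.filter fun M => (e ∈ M.1 ↔ e ∉ Mstar.1) with hW
  have hgap : I.bordaGap Mstar e =
      (I.reward Mstar : EReal) - W.sup fun M => (I.reward M : EReal) := by
    rw [bordaGap]
    congr 1
    split_ifs with h
    · congr 1
      ext M
      simp [hW, h]
    · congr 1
      ext M
      simp [hW, h]
  have hne : W.Nonempty := by
    obtain ⟨⟨M, hM⟩, N, hN⟩ := he
    by_cases h : e ∈ Mstar.1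
    · exact ⟨N, by simp [hW, h, hN]⟩
    · exact ⟨M, by simp [hW, h, hM]⟩
  obtain ⟨M, hM, hsup⟩ := Finset.exists_mem_eq_sup W hne fun M => (I.reward M : EReal)
  have hMW : e ∈ M.1 ↔ e ∉ Mstar.1 := by simpa [hW] using hM
  refine ⟨I.reward Mstar - I.reward M, sub_pos.2 (I.reward_lt_of_ne hw ?_), ?_, fun N hN => ?_⟩
  · rintro rfl
    tauto
  · rw [hgap, hsup, EReal.coe_sub]
  · have h1 : (I.reward N : EReal) ≤ W.sup fun M => (I.reward M : EReal) :=
      Finset.le_sup (f := fun M : MaxMatching I.G => (I.reward M : EReal)) (by simpa [hW] using hN)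
    rw [hsup, EReal.coe_le_coe_iff] at h1
    linarith

theorem bordaGap_eq_top {Mstar : MaxMatching I.G} {e : Edge I.G} (he : ¬ I.IsActive e) :
    I.bordaGap Mstar e = ⊤ := by
  classical
  rw [bordaGap]
  split_ifs with h
  · rw [Finset.filter_false_of_mem, Finset.sup_empty, EReal.coe_sub_bot]
    exact fun M _ hM => he ⟨⟨Mstar, h⟩, M, hM⟩
  · rw [Finset.filter_false_of_mem, Finset.sup_empty, EReal.coe_sub_bot]
    exact fun M _ hM => he ⟨⟨M, hM⟩, Mstar, h⟩

/-- The contribution of the edge `e` to the hardness. -/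
noncomputable def hardnessTerm (Mstar : MaxMatching I.G) (ε : ℝ) (e : Edge I.G) : ℝ :=
  (min (((width I.G : ℝ) : EReal) ^ 2 / I.bordaGap Mstar e ^ 2) ((1 / ε ^ 2 : ℝ) : EReal)).toReal

theorem hardnessTerm_of_gap {Mstar : MaxMatching I.G} {e : Edge I.G} {Δ : ℝ} (ε : ℝ)
    (h : I.bordaGap Mstar e = (Δ : EReal)) :
    I.hardnessTerm Mstar ε e = min ((width I.G : ℝ) ^ 2 / Δ ^ 2) (1 / ε ^ 2) := by
  rw [hardnessTerm, h, ← EReal.coe_pow, ← EReal.coe_pow, ← EReal.coe_div,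
    ← EReal.coe_strictMono.monotone.map_min, EReal.toReal_coe]

theorem hardnessTerm_of_not_isActive {Mstar : MaxMatching I.G} {e : Edge I.G} (ε : ℝ)
    (he : ¬ I.IsActive e) : I.hardnessTerm Mstar ε e = 0 := by
  have h : (⊤ : EReal) ^ 2 = ⊤ := by rw [sq]; rfl
  have h2 : (0 : ℝ) ≤ 1 / ε ^ 2 := by positivity
  rw [hardnessTerm, I.bordaGap_eq_top he, h, EReal.div_top, min_eq_left (by exact_mod_cast h2),
    EReal.toReal_zero]

theorem hardness_eq (Mstar : MaxMatching I.G) (ε : ℝ) :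
    I.hardness Mstar ε = ∑ e ∈ I.activeEdges, I.hardnessTerm Mstar ε e := by
  rw [hardness]
  refine (Finset.sum_subset (Finset.subset_univ _) fun e _ he => ?_).symm
  exact I.hardnessTerm_of_not_isActive ε fun h => he (I.mem_activeEdges.2 h)

/-- Starting from any matching that disagrees with `Mstar` about `e`, keep only the exchange on the
component of `e`: at most `width / 2` positions change, each costing at most `1`. Hence every active
edge contributes at least `1` to the hardness. -/
theorem gap_le_width {Mstar : MaxMatching I.G} {e : Edge I.G} (he : I.IsActive e) {Δ : ℝ}
    (hΔ : ∀ M : MaxMatching I.G, (e ∈ M.1 ↔ e ∉ Mstar.1) → Δ ≤ I.reward Mstar - I.reward M) :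
    Δ ≤ width I.G := by
  have hex : ∃ M : MaxMatching I.G, (e ∈ M.1 ↔ e ∉ Mstar.1) := by
    obtain ⟨⟨M, hM⟩, N, hN⟩ := he
    by_cases h : e ∈ Mstar.1
    · exact ⟨N, by simp [h, hN]⟩
    · exact ⟨M, by simp [h, hM]⟩
  obtain ⟨M, hM⟩ := hex
  have hne : I.edgeAt Mstar (pos e) ≠ I.edgeAt M (pos e) := by
    intro h
    rw [I.mem_iff_edgeAt_eq, I.mem_iff_edgeAt_eq, h] at hM
    tauto
  obtain ⟨J, hJ, -, hcard, ⟨N, hN⟩, -⟩ := I.exists_exchange Mstar M hne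
  have hNe : e ∈ N.1 ↔ e ∉ Mstar.1 := by
    rw [I.mem_iff_edgeAt_eq, hN, if_pos hJ, ← I.mem_iff_edgeAt_eq, hM]
  refine (hΔ N hNe).trans ?_
  rw [reward_eq, reward_eq, ← Finset.sum_sub_distrib]
  calc _ ≤ ∑ j : Fin ℓ, if j ∈ J then (1 : ℝ) else 0 := by
        refine Finset.sum_le_sum fun j _ => ?_
        rw [hN]
        split_ifs
        · have h1 := I.edgeReward_nonneg (I.edgeAt M j)
          have h2 := I.edgeReward_le_one (I.edgeAt Mstar j)
          linarith
        · simp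
    _ = (J.card : ℝ) := by simp
    _ ≤ _ := by exact_mod_cast (by omega : J.card ≤ width I.G)

theorem one_le_hardnessTerm {Mstar : MaxMatching I.G} (hw : I.IsBordaWinner Mstar) {ε : ℝ}
    (hε : 0 < ε) (hε1 : ε ≤ 1) {e : Edge I.G} (he : I.IsActive e) :
    1 ≤ I.hardnessTerm Mstar ε e := by
  obtain ⟨Δ, hpos, hgap, hΔ⟩ := I.exists_gap hw he
  rw [I.hardnessTerm_of_gap ε hgap]
  have h := I.gap_le_width he hΔ
  refine le_min ?_ ?_
  · rw [one_le_div (by positivity)]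
    gcongr
  · rw [one_le_div (by positivity)]
    exact pow_le_one₀ hε.le hε1

theorem card_activeEdges_le_hardness {Mstar : MaxMatching I.G} (hw : I.IsBordaWinner Mstar) {ε : ℝ}
    (hε : 0 < ε) (hε1 : ε ≤ 1) : (I.activeEdges.card : ℝ) ≤ I.hardness Mstar ε := by
  rw [I.hardness_eq, Finset.cast_card]
  exact Finset.sum_le_sum fun e he =>
    I.one_le_hardnessTerm hw hε hε1 (I.mem_activeEdges.1 he)

/-! ### The deterministic analysis of a round -/

section Round

variable {wbar r : Edge I.G → ℝ} {M : MaxMatching I.G}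

open Classical in
/-- The weights `wbar`, lowered by `r` on `M` and raised by `r` off `M`. -/
noncomputable def pessimistic (wbar r : Edge I.G → ℝ) (M : MaxMatching I.G) (e : Edge I.G) : ℝ :=
  if e ∈ M.1 then wbar e - r e else wbar e + r e

theorem adjusted_eq_pessimistic (δ ε : ℝ) (t : ℕ) (T : Edge I.G → ℕ) (wbar : Edge I.G → ℝ)
    (M : MaxMatching I.G) :
    I.adjusted δ ε t T wbar M = I.pessimistic wbar (fun e => I.radius δ t T e + ε / 4) M := by
  funext e
  simp only [adjusted, pessimistic]
  split_ifs <;> ring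

theorem edgeAt_mem_iff {N : MaxMatching I.G} {j : Fin ℓ} :
    I.edgeAt N j ∈ M.1 ↔ I.edgeAt M j = I.edgeAt N j := by
  rw [I.mem_iff_edgeAt_eq, I.pos_edgeAt]

theorem pessimistic_edgeAt_self (j : Fin ℓ) :
    I.pessimistic wbar r M (I.edgeAt M j) = wbar (I.edgeAt M j) - r (I.edgeAt M j) := by
  rw [pessimistic, if_pos (I.edgeAt_mem M j)]

theorem pessimistic_edgeAt_of_ne {N : MaxMatching I.G} {j : Fin ℓ}
    (h : I.edgeAt M j ≠ I.edgeAt N j) :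
    I.pessimistic wbar r M (I.edgeAt N j) = wbar (I.edgeAt N j) + r (I.edgeAt N j) := by
  rw [pessimistic, if_neg fun h' => h (I.edgeAt_mem_iff.1 h')]

/-- Under the confidence event, the adjusted weights overestimate the loss of `M`. -/
theorem reward_sub_le_pessimistic
    (hconf : ∀ e, I.IsActive e → |wbar e - I.edgeReward e| ≤ r e) (P : MaxMatching I.G) :
    I.reward P - I.reward M ≤
      ∑ e ∈ P.1, I.pessimistic wbar r M e - ∑ e ∈ M.1, I.pessimistic wbar r M e := by
  rw [reward_eq, reward_eq, I.sum_matching, I.sum_matching, ← Finset.sum_sub_distrib,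
    ← Finset.sum_sub_distrib]
  refine Finset.sum_le_sum fun j _ => ?_
  by_cases h : I.edgeAt M j = I.edgeAt P j
  · rw [h]; simp
  · rw [I.pessimistic_edgeAt_self, I.pessimistic_edgeAt_of_ne h]
    have h1 := abs_le.1 (hconf _ (I.isActive_edgeAt h))
    have h2 := abs_le.1 (hconf _ (I.isActive_edgeAt (Ne.symm h)))
    linarith [h1.1, h1.2, h2.1, h2.2]

/-- Since `M` is optimal for `wbar`, only the radii can make `N` better, by at most `2 * c` per
position. Failing to stop therefore forces a large radius. -/
theorem pessimistic_sub_le {N : MaxMatching I.G} {c : ℝ}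
    (hMopt : ∑ e ∈ N.1, wbar e ≤ ∑ e ∈ M.1, wbar e)
    (hc0 : 0 ≤ c)
    (hc : ∀ j, I.edgeAt M j ≠ I.edgeAt N j → r (I.edgeAt M j) ≤ c ∧ r (I.edgeAt N j) ≤ c) :
    ∑ e ∈ N.1, I.pessimistic wbar r M e - ∑ e ∈ M.1, I.pessimistic wbar r M e ≤ 2 * ℓ * c := by
  rw [I.sum_matching, I.sum_matching] at hMopt ⊢
  have h : ∑ j, (I.pessimistic wbar r M (I.edgeAt N j) - I.pessimistic wbar r M (I.edgeAt M j)) ≤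
      ∑ j, (wbar (I.edgeAt N j) - wbar (I.edgeAt M j) + 2 * c) := by
    refine Finset.sum_le_sum fun j _ => ?_
    by_cases h : I.edgeAt M j = I.edgeAt N j
    · rw [h]; simp [hc0]
    · rw [I.pessimistic_edgeAt_self, I.pessimistic_edgeAt_of_ne h]
      obtain ⟨h1, h2⟩ := hc j h
      linarith
  rw [Finset.sum_add_distrib, Finset.sum_sub_distrib, Finset.sum_sub_distrib] at h
  have h3 : ∑ _j : Fin ℓ, 2 * c = 2 * ℓ * c := by simp; ring
  linarith

/-- If the adjusted weights of `M` and `N` are maximal in the two senses of the algorithm, then the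
radii on their difference are at least a `3 * width` fraction of the gap of each of its edges. -/
theorem gap_le_of_mem_diff {N P : MaxMatching I.G} {c Δ : ℝ} {z : Edge I.G}
    (hconf : ∀ e, I.IsActive e → |wbar e - I.edgeReward e| ≤ r e)
    (hM : ∀ Q : MaxMatching I.G, ∑ e ∈ Q.1, wbar e ≤ ∑ e ∈ M.1, wbar e)
    (hN : ∀ Q : MaxMatching I.G,
      ∑ e ∈ Q.1, I.pessimistic wbar r M e ≤ ∑ e ∈ N.1, I.pessimistic wbar r M e)
    (hc : ∀ j, I.edgeAt M j ≠ I.edgeAt N j → r (I.edgeAt M j) ≤ c ∧ r (I.edgeAt N j) ≤ c)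
    (hz : z ∈ M.1 ↔ z ∉ N.1)
    (hΔ : ∀ Q : MaxMatching I.G, (z ∈ Q.1 ↔ z ∉ P.1) → Δ ≤ I.reward P - I.reward Q) :
    Δ ≤ 3 * c * width I.G := by
  classical
  have hMN : I.edgeAt M (pos z) ≠ I.edgeAt N (pos z) := by
    intro h
    rw [I.mem_iff_edgeAt_eq, I.mem_iff_edgeAt_eq, h] at hz
    tauto
  have hc0 : 0 ≤ c := ((abs_nonneg _).trans (hconf _ (I.isActive_edgeAt hMN))).trans (hc _ hMN).1
  set v := I.pessimistic wbar r M with hv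
  -- `Q` disagrees with `P` about `z`, uses only edges of `M` and `N`, and is nearly optimal for the
  -- adjusted weights `v`.
  obtain ⟨Q, hQz, hQ, hQv⟩ : ∃ Q : MaxMatching I.G, (z ∈ Q.1 ↔ z ∉ P.1) ∧
      (∀ j, I.edgeAt Q j = I.edgeAt M j ∨ I.edgeAt Q j = I.edgeAt N j) ∧
      ∑ e ∈ N.1, v e ≤ ∑ e ∈ Q.1, v e + c * width I.G := by
    by_cases hNz : z ∈ N.1 ↔ z ∉ P.1
    · exact ⟨N, hNz, fun j => Or.inr rfl, le_add_of_nonneg_right (by positivity)⟩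
    -- Here `M` is the one that disagrees with `P` about `z`, so the component of `z` in `N` is
    -- replaced by that of `M`. The mirror exchange `M'` cannot beat `M` for `wbar`, so only the
    -- radii are lost: `2 * c` on each of at most `width / 2` positions.
    · obtain ⟨J, hJ, hJne, hcard, ⟨M', hM'⟩, N', hN'⟩ := I.exists_exchange M N hMN
      refine ⟨N', ?_, fun j => ?_, ?_⟩
      · have : z ∈ N'.1 ↔ z ∈ M.1 := by
          rw [I.mem_iff_edgeAt_eq, hN', if_pos hJ, ← I.mem_iff_edgeAt_eq]
        tauto
      · rw [hN']; split_ifs <;> simp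
      · have h1 := hM M'
        rw [I.sum_matching, I.sum_matching] at h1 ⊢
        have h2 : ∑ j, (v (I.edgeAt N j) - v (I.edgeAt N' j)) ≤
            ∑ j, ((wbar (I.edgeAt M' j) - wbar (I.edgeAt M j)) +
              if j ∈ J then 2 * c else 0) := by
          refine Finset.sum_le_sum fun j _ => ?_
          rw [hN', hM']
          split_ifs with h
          · rw [hv, I.pessimistic_edgeAt_self, I.pessimistic_edgeAt_of_ne (hJne j h)]
            obtain ⟨h1, h2⟩ := hc j (hJne j h)
            linarith
          · simp
        rw [Finset.sum_add_distrib, Finset.sum_sub_distrib, Finset.sum_sub_distrib] at h2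
        have h3 : ∑ j : Fin ℓ, (if j ∈ J then 2 * c else 0) = c * (2 * J.card : ℕ) := by
          simp; ring
        have h4 : c * (2 * J.card : ℕ) ≤ c * width I.G := by gcongr
        linarith
  have hPQ : I.edgeAt P (pos z) ≠ I.edgeAt Q (pos z) := by
    intro h
    rw [I.mem_iff_edgeAt_eq, I.mem_iff_edgeAt_eq, h] at hQz
    tauto
  -- Second exchange, between `P` and `Q`: `P'` pays the gap `Δ`, while `Q'` cannot beat `N` for
  -- `v`. The cost `4 * c` on at most `width / 2` positions, plus the `c * width` lost by `Q`, gives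
  -- the factor `3`.
  obtain ⟨J, hJ, hJne, hcard, ⟨P', hP'⟩, Q', hQ'⟩ := I.exists_exchange P Q hPQ
  have hP'z : z ∈ P'.1 ↔ z ∉ P.1 := by
    rw [← hQz, I.mem_iff_edgeAt_eq, hP', if_pos hJ, ← I.mem_iff_edgeAt_eq]
  have h1 := hΔ P' hP'z
  have h2 := hN Q'
  rw [reward_eq, reward_eq] at h1
  have h3 : ∑ j, (I.edgeReward (I.edgeAt P j) - I.edgeReward (I.edgeAt P' j)) ≤
      ∑ j, ((v (I.edgeAt Q' j) - v (I.edgeAt Q j)) + if j ∈ J then 4 * c else 0) := by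
    refine Finset.sum_le_sum fun j _ => ?_
    rw [hQ', hP']
    split_ifs with h
    · have hne := hJne j h
      have hP := abs_le.1 (hconf _ (I.isActive_edgeAt hne))
      have hQj := abs_le.1 (hconf _ (I.isActive_edgeAt hne.symm))
      -- An edge of `P` may lie outside both `M` and `N`, where its radius is not controlled by `c`;
      -- but there `v` is optimistic and already dominates the reward.
      have hPv : I.edgeReward (I.edgeAt P j) ≤ v (I.edgeAt P j) + 2 * c := by
        by_cases hMP : I.edgeAt M j = I.edgeAt P j
        · have hMNj : I.edgeAt M j ≠ I.edgeAt N j := by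
            intro h'
            rcases hQ j with h'' | h''
            · exact hne (by rw [h'', hMP])
            · exact hne (by rw [h'', ← h', hMP])
          have := (hc j hMNj).1
          rw [← hMP] at hP ⊢
          rw [hv, I.pessimistic_edgeAt_self]
          linarith [hP.1]
        · rw [hv, I.pessimistic_edgeAt_of_ne hMP]
          linarith [hP.1]
      -- Dually, on `M` the weight `v` is already below the reward; otherwise the edge belongs to
      -- `N` and differs from that of `M`, so its radius is controlled.
      have hQv' : v (I.edgeAt Q j) - 2 * c ≤ I.edgeReward (I.edgeAt Q j) := by
        by_cases hMQ : I.edgeAt M j = I.edgeAt Q j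
        · rw [← hMQ] at hQj ⊢
          rw [hv, I.pessimistic_edgeAt_self]
          linarith [hQj.2]
        · have hQN := (hQ j).resolve_left fun h' => hMQ h'.symm
          have := (hc j (hQN ▸ hMQ)).2
          rw [hv, I.pessimistic_edgeAt_of_ne hMQ]
          rw [← hQN] at this
          linarith [hQj.2]
      linarith
    · simp
  rw [Finset.sum_add_distrib, Finset.sum_sub_distrib, Finset.sum_sub_distrib] at h3
  have h4 : ∑ j : Fin ℓ, (if j ∈ J then 4 * c else 0) = 2 * c * (2 * J.card : ℕ) := by
    simp; ring
  have h5 : 2 * c * (2 * J.card : ℕ) ≤ 2 * c * width I.G := by gcongr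
  rw [I.sum_matching, I.sum_matching] at h2
  rw [I.sum_matching, I.sum_matching] at hQv
  linarith

end Round

end Instance

theorem edge_ext {n ℓ : ℕ} {G : BipGraph n ℓ} {e f : Edge G} (hc : cand e = cand f)
    (hp : pos e = pos f) : e = f :=
  Subtype.ext (Prod.ext hc hp)

namespace Instance

variable {n ℓ : ℕ} (I : Instance n ℓ)

/-! ### Sampling bias -/

/-- The maximum matching obtained from a perfect matching of the augmented graph. -/
noncomputable def eliminated (x : PerfectMatching (augment I.G)) : MaxMatching I.G :=
  ⟨eliminate x.1, isMaxMatching_eliminate I.le_cands x.2⟩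

theorem mem_eliminated {x : PerfectMatching (augment I.G)} {e : Edge I.G} :
    e ∈ (I.eliminated x).1 ↔ ∃ e' ∈ x.1, cand e' = cand e ∧ (pos e').1 = (pos e).1 := by
  simp [eliminated, eliminate]

/-- Edges of a perfect matching at a genuine position are the edges of its elimination. -/
theorem cand_eq_of_mem (x : PerfectMatching (augment I.G)) {e : Edge (augment I.G)} (he : e ∈ x.1)
    (h : (pos e).1 < ℓ) : cand e = cand (I.edgeAt (I.eliminated x) ⟨(pos e).1, h⟩) := by
  have hmem := (Finset.mem_filter.1 e.2).2 h
  have h1 : (⟨_, hmem⟩ : Edge I.G) ∈ (I.eliminated x).1 :=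
    I.mem_eliminated.2 ⟨e, he, rfl, rfl⟩
  rw [mem_iff_edgeAt_eq] at h1
  exact (congrArg cand h1).symm

open Classical in
/-- The image of a set of edges of a bipartite graph under a permutation of the candidates. -/
noncomputable def relabel {H : BipGraph n n} (σ : Equiv.Perm (Fin n)) (x : Finset (Edge H)) :
    Finset (Edge H) :=
  Finset.univ.filter fun e => ∃ e' ∈ x, cand e = σ (cand e') ∧ pos e = pos e'

theorem mem_relabel {H : BipGraph n n} {σ : Equiv.Perm (Fin n)} {x : Finset (Edge H)}
    {e : Edge H} : e ∈ relabel σ x ↔ ∃ e' ∈ x, cand e = σ (cand e') ∧ pos e = pos e' := by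
  simp [relabel]

theorem relabel_subset {H : BipGraph n n} {σ : Equiv.Perm (Fin n)} {x y : Finset (Edge H)}
    (hx : ∀ e ∈ x, (σ (cand e), pos e) ∈ H) (h : relabel σ x = relabel σ y) : x ⊆ y := by
  intro e he
  have h1 : (⟨_, hx e he⟩ : Edge H) ∈ relabel σ x := mem_relabel.2 ⟨e, he, rfl, rfl⟩
  rw [h, mem_relabel] at h1
  obtain ⟨e', he', hc, hp⟩ := h1
  rwa [edge_ext (σ.injective hc) hp]

theorem isPerfectMatching_relabel {H : BipGraph n n} {σ : Equiv.Perm (Fin n)} {x : Finset (Edge H)}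
    (hx : ∀ e ∈ x, (σ (cand e), pos e) ∈ H) (h : IsPerfectMatching x) :
    IsPerfectMatching (relabel σ x) := by
  refine ⟨fun e he f hf hne => ?_, fun c => ?_, fun j => ?_⟩
  · obtain ⟨e', he', hec, hep⟩ := mem_relabel.1 he
    obtain ⟨f', hf', hfc, hfp⟩ := mem_relabel.1 hf
    have hne' : e' ≠ f' := by
      rintro rfl
      exact hne (edge_ext (hec.trans hfc.symm) (hep.trans hfp.symm))
    have := h.1 e' he' f' hf' hne'
    rw [hec, hep, hfc, hfp]
    exact ⟨fun h => this.1 (σ.injective h), this.2⟩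
  · obtain ⟨e, he, hec⟩ := h.2.1 (σ.symm c)
    refine ⟨⟨_, hx e he⟩, mem_relabel.2 ⟨e, he, rfl, rfl⟩, ?_⟩
    change σ (cand e) = c
    rw [hec, σ.apply_symm_apply]
  · obtain ⟨e, he, hep⟩ := h.2.2 j
    exact ⟨⟨_, hx e he⟩, mem_relabel.2 ⟨e, he, rfl, rfl⟩, hep⟩

-- Permute the candidates so that those of `M` go to those of `N` position by position. Fictitious
-- positions accept every candidate, so perfect matchings above `M` are sent injectively to perfect
-- matchings above `N`. By symmetry all fibres of the elimination have the same size.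
open Classical in
theorem card_fiber_le (M N : MaxMatching I.G) :
    (Finset.univ.filter fun x => I.eliminated x = M).card ≤
      (Finset.univ.filter fun x => I.eliminated x = N).card := by
  obtain ⟨σ, hσ⟩ := Equiv.Perm.exists_extending_pair _ _ (I.cand_edgeAt_injective M)
    (I.cand_edgeAt_injective N)
  have hmem : ∀ x : PerfectMatching (augment I.G), I.eliminated x = M →
      ∀ e ∈ x.1, (σ (cand e), pos e) ∈ augment I.G := by
    rintro x rfl e he
    refine Finset.mem_filter.2 ⟨Finset.mem_univ _, fun h => ?_⟩
    have h1 := I.cand_eq_of_mem x he h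
    have h2 : σ (cand e) = cand (I.edgeAt N ⟨(pos e).1, h⟩) := by rw [h1]; exact hσ _
    change (σ (cand e), (⟨(pos e).1, h⟩ : Fin ℓ)) ∈ I.G
    have h3 : (σ (cand e), (⟨(pos e).1, h⟩ : Fin ℓ)) = (I.edgeAt N ⟨(pos e).1, h⟩).1 :=
      Prod.ext h2 (I.pos_edgeAt N _).symm
    rw [h3]
    exact (I.edgeAt N _).2
  refine Finset.card_le_card_of_injOn
    (fun x => if h : I.eliminated x = M then
      ⟨relabel σ x.1, isPerfectMatching_relabel (hmem x h) x.2⟩ else x) (fun x hx => ?_)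
    fun x hx y hy hxy => ?_
  · have hxM : I.eliminated x = M := by simpa using hx
    simp only [hxM, dif_pos, Finset.coe_filter, Finset.mem_univ, true_and, Set.mem_ofPred_eq]
    refine (I.ext_edgeAt fun j => ?_).symm
    obtain ⟨e, he, hep⟩ := x.2.2.2 (Fin.castLE I.le_cands j)
    have hv : (pos e).1 = j.1 := by rw [hep]; rfl
    have hlt : (pos e).1 < ℓ := hv ▸ j.2
    have hj : (⟨(pos e).1, hlt⟩ : Fin ℓ) = j := Fin.ext hv
    have h1 := I.cand_eq_of_mem x he hlt
    rw [hxM, hj] at h1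
    have h2 : I.edgeAt N j ∈ (I.eliminated
        ⟨relabel σ x.1, isPerfectMatching_relabel (hmem x hxM) x.2⟩).1 := by
      refine I.mem_eliminated.2 ⟨⟨_, hmem x hxM e he⟩, mem_relabel.2 ⟨e, he, rfl, rfl⟩, ?_, ?_⟩
      · change σ (cand e) = _
        rw [h1]; exact hσ j
      · rw [I.pos_edgeAt]; exact hv
    rw [mem_iff_edgeAt_eq, I.pos_edgeAt] at h2
    exact h2.symm
  · have hxM : I.eliminated x = M := by simpa using hx
    have hyM : I.eliminated y = M := by simpa using hy
    simp only [hxM, hyM, dif_pos, Subtype.mk.injEq] at hxy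
    exact Subtype.ext ((relabel_subset (hmem x hxM) hxy).antisymm
      (relabel_subset (hmem y hyM) hxy.symm))

theorem average_eliminated (f : MaxMatching I.G → ℝ) :
    (1 / (Fintype.card (PerfectMatching (augment I.G)) : ℝ)) * ∑ x, f (I.eliminated x) =
      (1 / (Fintype.card (MaxMatching I.G) : ℝ)) * ∑ M, f M := by
  classical
  obtain ⟨M₀⟩ := I.nonempty_maxMatching
  set k := (Finset.univ.filter fun x => I.eliminated x = M₀).card with hk
  have hfib : ∀ M, (Finset.univ.filter fun x => I.eliminated x = M).card = k := fun M =>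
    (I.card_fiber_le M M₀).antisymm (I.card_fiber_le M₀ M)
  have hcard : Fintype.card (PerfectMatching (augment I.G)) =
      Fintype.card (MaxMatching I.G) * k := by
    rw [← Finset.card_univ, Finset.card_eq_sum_card_fiberwise (f := I.eliminated)
      (t := Finset.univ) fun _ _ => Finset.mem_coe.2 (Finset.mem_univ _)]
    simp [hfib]
  have hsum : ∑ x, f (I.eliminated x) = k * ∑ M, f M := by
    rw [← Finset.sum_fiberwise Finset.univ I.eliminated, Finset.mul_sum]
    refine Finset.sum_congr rfl fun M _ => ?_
    rw [Finset.sum_congr rfl fun x hx => by rw [(Finset.mem_filter.1 hx).2], Finset.sum_const,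
      hfib, nsmul_eq_mul]
  have hpos : (0 : ℝ) < Fintype.card (PerfectMatching (augment I.G)) := by
    have := I.nonempty_perfect
    exact_mod_cast Fintype.card_pos
  have hMpos := I.card_maxMatching_pos
  rw [hsum, hcard]
  rw [hcard] at hpos
  push_cast at hpos ⊢
  have hk0 : (k : ℝ) ≠ 0 := fun h => by simp [h] at hpos
  field_simp

/-- The probability that `e` wins its duel against the edge of a sampled matching. -/
noncomputable def winProb (S : AlmostUniformSampler) (η : ℝ) (e : Edge I.G) : ℝ :=
  ∑ N, (I.sampleMatching S η N).toReal * I.p e (I.edgeAt N (pos e))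

theorem sum_sampleMatching (S : AlmostUniformSampler) (η : ℝ) (f : MaxMatching I.G → ℝ) :
    ∑ N, (I.sampleMatching S η N).toReal * f N =
      ∑ x, (S.law (augment I.G) I.nonempty_perfect η x).toReal * f (I.eliminated x) := by
  classical
  have h : ∀ N, (I.sampleMatching S η N).toReal =
      ∑ x, if N = I.eliminated x then
        (S.law (augment I.G) I.nonempty_perfect η x).toReal else 0 := by
    intro N
    rw [sampleMatching, PMF.map_apply, tsum_fintype, ENNReal.toReal_sum]
    · refine Finset.sum_congr rfl fun x _ => ?_
      by_cases hx : N = I.eliminated x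
      · rw [if_pos hx, if_pos (by exact hx)]
      · rw [if_neg hx, if_neg (by exact hx), ENNReal.toReal_zero]
    · intro x _
      split_ifs
      · exact PMF.apply_ne_top _ _
      · exact ENNReal.zero_ne_top
  simp only [h, Finset.sum_mul]
  rw [Finset.sum_comm]
  refine Finset.sum_congr rfl fun x _ => ?_
  simp [ite_mul]

/-- Both sides average the same function with values in `[0, 1]` over perfect matchings, so they
differ by at most the `ℓ¹` distance of the laws, which is twice the total variation distance. -/
theorem abs_winProb_sub_le (S : AlmostUniformSampler) {η : ℝ} (hη : 0 < η) (e : Edge I.G) :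
    |I.winProb S η e - I.edgeReward e| ≤ 2 * η := by
  have h := S.tv_le (augment I.G) I.nonempty_perfect η hη
  rw [winProb, I.sum_sampleMatching S η fun N => I.p e (I.edgeAt N (pos e)), edgeReward,
    ← I.average_eliminated, Finset.mul_sum, ← Finset.sum_sub_distrib]
  refine (Finset.abs_sum_le_sum_abs _ _).trans ?_
  refine (Finset.sum_le_sum (g := fun x => |(S.law (augment I.G) I.nonempty_perfect η x).toReal -
    1 / (Fintype.card (PerfectMatching (augment I.G)) : ℝ)|) fun x _ => ?_).trans (by linarith)
  rw [← sub_mul, abs_mul]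
  refine mul_le_of_le_one_right (abs_nonneg _) ?_
  rw [abs_of_nonneg (I.p_nonneg _ _)]
  exact I.p_le_one _ _

theorem sum_toReal_sampleMatching (S : AlmostUniformSampler) (η : ℝ) :
    ∑ N, (I.sampleMatching S η N).toReal = 1 := by
  have h := (I.sampleMatching S η).tsum_coe
  rw [tsum_fintype] at h
  rw [← ENNReal.toReal_sum fun _ _ => PMF.apply_ne_top _ _, h, ENNReal.toReal_one]

theorem winProb_nonneg (S : AlmostUniformSampler) (η : ℝ) (e : Edge I.G) : 0 ≤ I.winProb S η e :=
  Finset.sum_nonneg fun _ _ => mul_nonneg ENNReal.toReal_nonneg (I.p_nonneg _ _)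

theorem winProb_le_one (S : AlmostUniformSampler) (η : ℝ) (e : Edge I.G) :
    I.winProb S η e ≤ 1 := by
  rw [← I.sum_toReal_sampleMatching S η]
  exact Finset.sum_le_sum fun _ _ => mul_le_of_le_one_right ENNReal.toReal_nonneg (I.p_le_one _ _)

end Instance

/-! ### Expectations under probability mass functions -/

theorem tsum_pure_mul {α : Type*} (a : α) (g : α → ℝ≥0∞) : ∑' b, PMF.pure a b * g b = g a := by
  rw [tsum_eq_single a]
  · simp
  · intro b hb
    rw [PMF.pure_apply_of_ne _ _ hb, zero_mul]

theorem tsum_bind_mul {α β : Type*} (p : PMF α) (f : α → PMF β) (g : β → ℝ≥0∞) :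
    ∑' b, p.bind f b * g b = ∑' a, p a * ∑' b, f a b * g b := by
  simp only [PMF.bind_apply, ← ENNReal.tsum_mul_right, ← ENNReal.tsum_mul_left]
  rw [ENNReal.tsum_comm]
  simp only [mul_assoc]

theorem tsum_map_mul {α β : Type*} (p : PMF α) (f : α → β) (g : β → ℝ≥0∞) :
    ∑' b, p.map f b * g b = ∑' a, p a * g (f a) := by
  rw [← PMF.bind_pure_comp, tsum_bind_mul]
  simp only [Function.comp, tsum_pure_mul]

/-- Markov's inequality. -/
theorem toOuterMeasure_le_of_le_tsum {α : Type*} (p : PMF α) (g : α → ℝ≥0∞)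
    (hg : ∑' a, p a * g a ≤ 1) {b : ℝ} (hb : 0 < b) {s : Set α}
    (hs : ∀ a ∈ s, ENNReal.ofReal b ≤ g a) : p.toOuterMeasure s ≤ ENNReal.ofReal (1 / b) := by
  have hb' : ENNReal.ofReal b ≠ 0 := by simpa using hb
  rw [one_div, ENNReal.ofReal_inv_of_pos hb, ENNReal.le_inv_iff_mul_le,
    PMF.toOuterMeasure_apply, ← ENNReal.tsum_mul_right]
  refine le_trans (ENNReal.tsum_le_tsum fun a => ?_) hg
  by_cases ha : a ∈ s
  · rw [Set.indicator_of_mem ha]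
    gcongr
    exact hs a ha
  · simp [Set.indicator_of_notMem ha]

/-- Hoeffding's lemma for a variable in `[0, 1]`, applied to a coin of bias `q`. -/
theorem bernoulli_mgf_le {q : ℝ} (h0 : 0 ≤ q) (h1 : q ≤ 1) (lam : ℝ) :
    q * Real.exp (lam * (1 - q)) + (1 - q) * Real.exp (lam * (0 - q)) ≤
      Real.exp (lam ^ 2 / 8) := by
  have h1' : 0 ≤ 1 - q := sub_nonneg.2 h1
  let P : PMF Bool := PMF.ofFintype
    (fun b => if b then ENNReal.ofReal q else ENNReal.ofReal (1 - q)) (by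
      simp [← ENNReal.ofReal_add h0 h1'])
  have hint : ∀ f : Bool → ℝ, ∫ b, f b ∂P.toMeasure = q * f true + (1 - q) * f false := fun f => by
    rw [PMF.integral_eq_sum]
    simp [P, PMF.ofFintype_apply, ENNReal.toReal_ofReal h0, ENNReal.toReal_ofReal h1']
  let X : Bool → ℝ := fun b => if b then 1 else 0
  have hX : ∫ b, X b ∂P.toMeasure = q := by rw [hint]; simp [X]
  have h := (ProbabilityTheory.hasSubgaussianMGF_of_mem_Icc (μ := P.toMeasure) (X := X)
    (a := 0) (b := 1) (measurable_of_finite X).aemeasurable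
    (Filter.Eventually.of_forall fun b => by cases b <;> simp [X])).mgf_le lam
  rw [hX, ProbabilityTheory.mgf, hint] at h
  simp only [X, if_true] at h
  refine h.trans (le_of_eq ?_)
  congr 1
  simp
  ring

namespace Instance

variable {n ℓ : ℕ} (I : Instance n ℓ)

theorem tsum_duel_mul (e e' : Edge I.G) (f : Bool → ℝ≥0∞) :
    ∑' b, I.duel e e' b * f b =
      ENNReal.ofReal (I.p e e') * f true + ENNReal.ofReal (1 - I.p e e') * f false := by
  rw [tsum_fintype, Fintype.sum_bool]
  simp [duel, PMF.ofFintype_apply]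

/-- The expectation is affine in the winning probability, so averaging over the sampled matching
leaves a single coin of bias `winProb`. -/
theorem tsum_sample_duel_le_one (S : AlmostUniformSampler) (η : ℝ) (e : Edge I.G) (lam : ℝ) :
    ∑' N, I.sampleMatching S η N * ∑' b, I.duel e (I.edgeAt N (pos e)) b *
      ENNReal.ofReal (Real.exp (lam * ((if b then 1 else 0) - I.winProb S η e) - lam ^ 2 / 8)) ≤
      1 := by
  set q := I.winProb S η e with hq
  set a := Real.exp (lam * (1 - q) - lam ^ 2 / 8) with ha
  set b := Real.exp (lam * (0 - q) - lam ^ 2 / 8) with hb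
  have ha0 : 0 ≤ a := (Real.exp_pos _).le
  have hb0 : 0 ≤ b := (Real.exp_pos _).le
  have hterm : ∀ N, I.sampleMatching S η N * ∑' b, I.duel e (I.edgeAt N (pos e)) b *
      ENNReal.ofReal (Real.exp (lam * ((if b then 1 else 0) - q) - lam ^ 2 / 8)) =
      ENNReal.ofReal ((I.sampleMatching S η N).toReal *
        (I.p e (I.edgeAt N (pos e)) * a + (1 - I.p e (I.edgeAt N (pos e))) * b)) := fun N => by
    have hp0 := I.p_nonneg e (I.edgeAt N (pos e))
    have hp1 := sub_nonneg.2 (I.p_le_one e (I.edgeAt N (pos e)))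
    rw [tsum_duel_mul, ENNReal.ofReal_mul ENNReal.toReal_nonneg,
      ENNReal.ofReal_toReal (PMF.apply_ne_top _ _),
      ENNReal.ofReal_add (mul_nonneg hp0 ha0) (mul_nonneg hp1 hb0), ENNReal.ofReal_mul hp0,
      ENNReal.ofReal_mul hp1]
    simp [ha, hb]
  simp only [hterm]
  rw [tsum_fintype, ← ENNReal.ofReal_sum_of_nonneg fun N _ =>
    mul_nonneg ENNReal.toReal_nonneg (add_nonneg (mul_nonneg (I.p_nonneg _ _) ha0)
      (mul_nonneg (sub_nonneg.2 (I.p_le_one _ _)) hb0)), ENNReal.ofReal_le_one]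
  have hsum : ∑ N, (I.sampleMatching S η N).toReal *
      (I.p e (I.edgeAt N (pos e)) * a + (1 - I.p e (I.edgeAt N (pos e))) * b) =
      q * a + (1 - q) * b := by
    have h1 : (1 - q) * b = (∑ N, (I.sampleMatching S η N).toReal - q) * b := by
      rw [I.sum_toReal_sampleMatching]
    rw [h1, hq, winProb, Finset.sum_mul, ← Finset.sum_sub_distrib,
      Finset.sum_mul, ← Finset.sum_add_distrib]
    exact Finset.sum_congr rfl fun _ _ => by ring
  rw [hsum, ha, hb, Real.exp_sub, Real.exp_sub, mul_div_assoc', mul_div_assoc', ← add_div,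
    div_le_one (Real.exp_pos _)]
  exact bernoulli_mgf_le (I.winProb_nonneg S η e) (I.winProb_le_one S η e) lam

/-! ### The exponential supermartingale of an edge -/

/-- The exponential supermartingale at `lam` of the centered sum of the outcomes of `e`. -/
noncomputable def potential (e : Edge I.G) (q lam : ℝ) : Config I.G → ℝ≥0∞
  | .returned _ _ => 0
  | .running _ T wbar =>
    ENNReal.ofReal (Real.exp (lam * (T e * (wbar e - q)) - lam ^ 2 / 8 * T e))

variable (S : AlmostUniformSampler) (O : MWMC I.G) (A : ArgMax I.G) (δ ε : ℝ)

/-- A duel of `e` multiplies the potential by a factor of mean at most `1`, a duel of another edge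
leaves it unchanged, and halting sets it to `0`. -/
theorem tsum_step_potential_le (e : Edge I.G) (lam : ℝ) (s : Config I.G) :
    ∑' s', I.step S O A δ ε s s' * I.potential e (I.winProb S (ε / 8) e) lam s' ≤
      I.potential e (I.winProb S (ε / 8) e) lam s := by
  set q := I.winProb S (ε / 8) e with hq
  cases s with
  | returned out k =>
    change ∑' s', PMF.pure (Config.returned out k) s' * _ ≤ _
    rw [tsum_pure_mul]
  | running t T wbar =>
    simp only [step]
    split_ifs with h1 h2
    · rw [tsum_pure_mul]
      exact zero_le
    · set z := A.sel (I.radius δ t T) _ h2 with hz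
      simp only [tsum_bind_mul, tsum_map_mul]
      rcases eq_or_ne e z with hez | hez
      · have hpot : ∀ b : Bool, I.potential e q lam
            (.running (t + 1) (Function.update T z (T z + 1))
              (Function.update wbar z ((wbar z * T z + if b then 1 else 0) / (T z + 1)))) =
            ENNReal.ofReal (Real.exp (lam * ((if b then 1 else 0) - q) - lam ^ 2 / 8)) *
              I.potential e q lam (.running t T wbar) := fun b => by
          have hT : ((T e : ℝ) + 1) ≠ 0 := by positivity
          simp only [potential]
          rw [← ENNReal.ofReal_mul (Real.exp_pos _).le, ← Real.exp_add, ← hez]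
          congr 2
          simp only [Function.update_self]
          push_cast
          field_simp
          ring
        simp only [hpot, ← mul_assoc]
        simp only [ENNReal.tsum_mul_right, ← mul_assoc]
        refine mul_le_of_le_one_left (zero_le) ?_
        rw [← hez]
        exact I.tsum_sample_duel_le_one S (ε / 8) e lam
      · have hpot : ∀ b : Bool, I.potential e q lam
            (.running (t + 1) (Function.update T z (T z + 1))
              (Function.update wbar z ((wbar z * T z + if b then 1 else 0) / (T z + 1)))) =
            I.potential e q lam (.running t T wbar) := fun b => by
          simp only [potential, Function.update_of_ne hez]
        simp only [hpot, ENNReal.tsum_mul_right, PMF.tsum_coe, one_mul]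
        exact le_rfl
    · rw [tsum_pure_mul]
      exact zero_le

theorem tsum_configLaw_potential_le (e : Edge I.G) (lam : ℝ) (k : ℕ) :
    ∑' s, I.configLaw S O A δ ε k s * I.potential e (I.winProb S (ε / 8) e) lam s ≤ 1 := by
  induction k with
  | zero =>
    rw [configLaw, tsum_pure_mul]
    simp [potential]
  | succ k ih =>
    rw [configLaw, tsum_bind_mul]
    refine le_trans (ENNReal.tsum_le_tsum fun s => ?_) ih
    gcongr
    exact I.tsum_step_potential_le S O A δ ε e lam s

/-- A Chernoff bound for the empirical mean of `e` after exactly `m` duels. -/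
theorem deviation_le (e : Edge I.G) (k m : ℕ) {c b : ℝ} (hc : 0 ≤ c)
    (hb : 0 < b) (hbc : b ≤ Real.exp (2 * c ^ 2 * m)) :
    (I.configLaw S O A δ ε k).toOuterMeasure
      {s | ∃ t T wbar, s = .running t T wbar ∧ T e = m ∧
        c ≤ |wbar e - I.winProb S (ε / 8) e|} ≤ ENNReal.ofReal (2 * (1 / b)) := by
  set q := I.winProb S (ε / 8) e with hq
  have key : ∀ σ : ℝ, σ ^ 2 = 1 → (I.configLaw S O A δ ε k).toOuterMeasure
      {s | ∃ t T wbar, s = .running t T wbar ∧ T e = m ∧ c ≤ σ * (wbar e - q)} ≤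
      ENNReal.ofReal (1 / b) := by
    intro σ hσ
    -- The parameter of modulus `4 * c` maximizes `lam * c * m - lam ^ 2 / 8 * m`, with value `2 * c
    -- ^ 2 * m`; the sign `σ` selects the tail.
    refine toOuterMeasure_le_of_le_tsum _ _
      (I.tsum_configLaw_potential_le S O A δ ε e (4 * c * σ) k) hb ?_
    rintro _ ⟨t, T, wbar, rfl, hT, hdev⟩
    refine ENNReal.ofReal_le_ofReal (hbc.trans (Real.exp_le_exp.2 ?_))
    rw [hT]
    have h1 : 0 ≤ 4 * c * m * (σ * (wbar e - q) - c) :=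
      mul_nonneg (by positivity) (sub_nonneg.2 hdev)
    have h2 : (4 * c * σ) ^ 2 = 16 * c ^ 2 := by rw [mul_pow, hσ]; ring
    rw [h2]
    nlinarith
  have h := MeasureTheory.measure_union_le (μ := (I.configLaw S O A δ ε k).toOuterMeasure)
    {s | ∃ t T wbar, s = Config.running t T wbar ∧ T e = m ∧ c ≤ 1 * (wbar e - q)}
    {s | ∃ t T wbar, s = Config.running t T wbar ∧ T e = m ∧ c ≤ -1 * (wbar e - q)}
  refine le_trans (MeasureTheory.measure_mono ?_) (h.trans
    ((add_le_add (key 1 (by norm_num)) (key (-1) (by norm_num))).trans_eq ?_))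
  · rintro _ ⟨t, T, wbar, rfl, hT, hdev⟩
    rcases le_abs.1 hdev with h | h
    · exact Or.inl ⟨t, T, wbar, rfl, hT, by linarith⟩
    · exact Or.inr ⟨t, T, wbar, rfl, hT, by linarith⟩
  · rw [← ENNReal.ofReal_add (by positivity) (by positivity), two_mul]

/-! ### One round of the algorithm -/

/-- The logarithm in the confidence radius of round `t`. -/
noncomputable def logTerm (δ : ℝ) (t : ℕ) : ℝ := Real.log (4 * numDuels I.G * (t : ℝ) ^ 3 / δ)

theorem radius_nonneg (δ : ℝ) (t : ℕ) (T : Edge I.G → ℕ) (e : Edge I.G) :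
    0 ≤ I.radius δ t T e := Real.sqrt_nonneg _

/-- The confidence event of a round. -/
def Confident (δ ε : ℝ) (t : ℕ) (T : Edge I.G → ℕ) (wbar : Edge I.G → ℝ) : Prop :=
  ∀ e, I.IsActive e → |wbar e - I.edgeReward e| ≤ I.radius δ t T e + ε / 4

theorem one_le_numDuels {e : Edge I.G} (he : I.IsActive e) : 1 ≤ numDuels I.G := by
  have h1 := I.card_activeEdges_le
  have h2 : (2 : ℝ) ≤ I.activeEdges.card := by
    exact_mod_cast I.two_le_card_activeEdges (I.mem_activeEdges.2 he)
  linarith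

theorem logTerm_mono {δ : ℝ} (hδ : 0 < δ) (hK : 0 < numDuels I.G) {t u : ℕ} (ht : 1 ≤ t)
    (htu : t ≤ u) : I.logTerm δ t ≤ I.logTerm δ u := by
  have h1 : (0 : ℝ) < t := by exact_mod_cast ht
  have h2 : (t : ℝ) ≤ u := by exact_mod_cast htu
  unfold logTerm
  apply Real.log_le_log (by positivity)
  gcongr

theorem one_le_logTerm {δ : ℝ} (hδ : 0 < δ) (hδ1 : δ < 1) (hK : 1 ≤ numDuels I.G) {t : ℕ}
    (ht : 1 ≤ t) : 1 ≤ I.logTerm δ t := by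
  have h1 : (1 : ℝ) ≤ (t : ℝ) ^ 3 := one_le_pow₀ (by exact_mod_cast ht)
  have h2 : (4 : ℝ) ≤ 4 * numDuels I.G * (t : ℝ) ^ 3 / δ := by
    rw [le_div_iff₀ hδ]
    nlinarith [mul_nonneg (sub_nonneg.2 hK) (sub_nonneg.2 h1)]
  rw [logTerm, Real.le_log_iff_exp_le (by linarith)]
  linarith [Real.exp_one_lt_d9]

section Step

variable {S : AlmostUniformSampler} {O : MWMC I.G} {A : ArgMax I.G} {δ ε : ℝ} {t : ℕ}
  {T : Edge I.G → ℕ} {wbar : Edge I.G → ℝ} {M N : MaxMatching I.G}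

theorem borda_sub_le_of_halt (hconf : I.Confident δ ε t T wbar) (hε : 0 < ε)
    (hN : ∀ Q : MaxMatching I.G, ∑ e ∈ Q.1, I.adjusted δ ε t T wbar M e ≤
      ∑ e ∈ N.1, I.adjusted δ ε t T wbar M e)
    (hhalt : ∑ e ∈ N.1, I.adjusted δ ε t T wbar M e - ∑ e ∈ M.1, I.adjusted δ ε t T wbar M e ≤
      ℓ * ε) (P : MaxMatching I.G) : I.borda P - ε ≤ I.borda M := by
  rw [adjusted_eq_pessimistic] at hN hhalt
  have h1 := I.reward_sub_le_pessimistic (M := M) hconf P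
  have h2 := hN P
  have h3 : I.reward P - I.reward M ≤ ℓ * ε := by linarith
  rw [borda_eq, borda_eq]
  -- For `ℓ = 0` the factor `1 / ℓ` is `0` by convention and both scores vanish.
  rcases Nat.eq_zero_or_pos ℓ with h | h
  · subst h; simp [hε.le]
  · have hℓ : (0 : ℝ) < ℓ := by exact_mod_cast h
    have h4 : 1 / (ℓ : ℝ) * (I.reward P - I.reward M) ≤ 1 / (ℓ : ℝ) * (ℓ * ε) := by gcongr
    have h5 : 1 / (ℓ : ℝ) * (ℓ * ε) = ε := by field_simp
    linarith

/-- An edge that is played under the confidence event has been played few times before. -/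
theorem pulls_le_of_pulled {Mstar : MaxMatching I.G} (hw : I.IsBordaWinner Mstar)
    (hδ : 0 < δ) (hδ1 : δ < 1) (hε : 0 < ε) (ht : 1 ≤ t) (hconf : I.Confident δ ε t T wbar)
    (hM : ∀ Q : MaxMatching I.G, ∑ e ∈ Q.1, wbar e ≤ ∑ e ∈ M.1, wbar e)
    (hN : ∀ Q : MaxMatching I.G, ∑ e ∈ Q.1, I.adjusted δ ε t T wbar M e ≤
      ∑ e ∈ N.1, I.adjusted δ ε t T wbar M e)
    (hhalt : ¬ ∑ e ∈ N.1, I.adjusted δ ε t T wbar M e - ∑ e ∈ M.1, I.adjusted δ ε t T wbar M e ≤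
      ℓ * ε)
    {z : Edge I.G} (hz : z ∈ (N.1 \ M.1) ∪ (M.1 \ N.1)) (hact : I.IsActive z)
    (hmax : ∀ e ∈ (N.1 \ M.1) ∪ (M.1 \ N.1), I.radius δ t T e ≤ I.radius δ t T z) :
    (T z : ℝ) ≤ 18 * I.hardnessTerm Mstar ε z * I.logTerm δ t := by
  rw [adjusted_eq_pessimistic] at hN hhalt
  set r := I.radius δ t T z with hr
  have hr0 : 0 ≤ r := I.radius_nonneg δ t T z
  have hc : ∀ j, I.edgeAt M j ≠ I.edgeAt N j →
      I.radius δ t T (I.edgeAt M j) + ε / 4 ≤ r + ε / 4 ∧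
      I.radius δ t T (I.edgeAt N j) + ε / 4 ≤ r + ε / 4 := by
    intro j hj
    have h1 := hmax (I.edgeAt M j) (Finset.mem_union_right _ (Finset.mem_sdiff.2
      ⟨I.edgeAt_mem M j, fun h => hj (I.edgeAt_mem_iff.1 h).symm⟩))
    have h2 := hmax (I.edgeAt N j) (Finset.mem_union_left _ (Finset.mem_sdiff.2
      ⟨I.edgeAt_mem N j, fun h => hj (I.edgeAt_mem_iff.1 h)⟩))
    exact ⟨by linarith, by linarith⟩
  have hℓ : (0 : ℝ) < ℓ := by exact_mod_cast (pos z).pos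
  -- Not stopping means `ℓ * ε < 2 * ℓ * (r + ε / 4)`.
  have hεr : ε / 4 < r := by
    have h1 := I.pessimistic_sub_le (r := fun e => I.radius δ t T e + ε / 4) (c := r + ε / 4) (hM N)
      (by positivity) hc
    rw [not_le] at hhalt
    have h2 : (ℓ : ℝ) * ε < ℓ * (2 * (r + ε / 4)) := by linarith
    have h3 := lt_of_mul_lt_mul_left h2 hℓ.le
    linarith
  have hzMN : z ∈ M.1 ↔ z ∉ N.1 := by
    rw [Finset.mem_union, Finset.mem_sdiff, Finset.mem_sdiff] at hz
    tauto
  obtain ⟨Δ, hΔ0, hgap, hΔ⟩ := I.exists_gap hw hact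
  have hgapr := I.gap_le_of_mem_diff hconf hM hN hc hzMN hΔ
  have hwidth : (0 : ℝ) < width I.G := hΔ0.trans_le (I.gap_le_width hact hΔ)
  -- The slack is absorbed: `3 * (r + ε / 4) ≤ 6 * r`.
  have hΔr : Δ ≤ 6 * r * width I.G := by nlinarith
  rw [I.hardnessTerm_of_gap ε hgap]
  have hL : 1 ≤ I.logTerm δ t := I.one_le_logTerm hδ hδ1 (I.one_le_numDuels hact) ht
  rcases Nat.eq_zero_or_pos (T z) with h0 | hT
  · rw [h0, Nat.cast_zero]
    have : 0 ≤ min ((width I.G : ℝ) ^ 2 / Δ ^ 2) (1 / ε ^ 2) := by positivity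
    positivity
  · have hT' : (0 : ℝ) < T z := by exact_mod_cast hT
    have hr2 : r ^ 2 = I.logTerm δ t / (2 * T z) := by
      rw [hr, radius, if_neg hT.ne', ← logTerm, Real.sq_sqrt (by positivity)]
    have hTr : T z * r ^ 2 * 2 = I.logTerm δ t := by rw [hr2]; field_simp
    have h18 : T z = 18 * ((1 / (36 * r ^ 2)) * I.logTerm δ t) := by
      rw [← hTr]
      have : r ≠ 0 := by linarith
      field_simp
      norm_num
    have hrpos : 0 < r := by linarith
    have hmin : 1 / (36 * r ^ 2) ≤ min ((width I.G : ℝ) ^ 2 / Δ ^ 2) (1 / ε ^ 2) := by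
      refine le_min ?_ ?_
      · rw [div_le_div_iff₀ (by positivity) (by positivity)]
        have := pow_le_pow_left₀ hΔ0.le hΔr 2
        nlinarith
      · rw [div_le_div_iff₀ (by positivity) (by positivity)]
        have := pow_le_pow_left₀ (by positivity) hεr.le 2
        nlinarith [sq_nonneg r]
    rw [h18, mul_assoc]
    gcongr

/-- All that the analysis needs of a round. The new empirical mean is an arbitrary `x`, because its
accuracy is supplied separately by the confidence event. -/
theorem mem_support_step_running (hε : 0 ≤ ε) {s : Config I.G}
    (hs : s ∈ (I.step S O A δ ε (.running t T wbar)).support) :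
    ∃ M N : MaxMatching I.G,
      (∀ Q : MaxMatching I.G, ∑ e ∈ Q.1, wbar e ≤ ∑ e ∈ M.1, wbar e) ∧
      (∀ Q : MaxMatching I.G, ∑ e ∈ Q.1, I.adjusted δ ε t T wbar M e ≤
        ∑ e ∈ N.1, I.adjusted δ ε t T wbar M e) ∧
      ((∑ e ∈ N.1, I.adjusted δ ε t T wbar M e - ∑ e ∈ M.1, I.adjusted δ ε t T wbar M e ≤ ℓ * ε ∧
          s = .returned M (∑ e, T e)) ∨
        (¬ ∑ e ∈ N.1, I.adjusted δ ε t T wbar M e - ∑ e ∈ M.1, I.adjusted δ ε t T wbar M e ≤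
          ℓ * ε ∧ ∃ z ∈ (N.1 \ M.1) ∪ (M.1 \ N.1),
            (∀ e ∈ (N.1 \ M.1) ∪ (M.1 \ N.1), I.radius δ t T e ≤ I.radius δ t T z) ∧
            ∃ x : ℝ, s = .running (t + 1) (Function.update T z (T z + 1))
              (Function.update wbar z x))) := by
  refine ⟨O.out wbar, O.out (I.adjusted δ ε t T wbar (O.out wbar)), O.out_max _, O.out_max _, ?_⟩
  simp only [step] at hs
  split_ifs at hs with h1 h2
  · exact Or.inl ⟨h1, by simpa using hs⟩
  · refine Or.inr ⟨h1, _, A.sel_mem (I.radius δ t T) _ h2, A.sel_max (I.radius δ t T) _ h2, ?_⟩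
    obtain ⟨N, -, hN⟩ := (PMF.mem_support_bind_iff _ _ _).1 hs
    obtain ⟨b, -, hb⟩ := (PMF.mem_support_map_iff _ _ _).1 hN
    exact ⟨_, hb.symm⟩
  · exfalso
    rw [Finset.not_nonempty_iff_eq_empty, Finset.union_eq_empty, Finset.sdiff_eq_empty_iff_subset,
      Finset.sdiff_eq_empty_iff_subset] at h2
    rw [h2.1.antisymm h2.2, sub_self] at h1
    exact h1 (by positivity)

theorem isActive_of_mem_diff {z : Edge I.G} (hz : z ∈ (N.1 \ M.1) ∪ (M.1 \ N.1)) :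
    I.IsActive z := by
  rw [Finset.mem_union, Finset.mem_sdiff, Finset.mem_sdiff] at hz
  rcases hz with ⟨h1, h2⟩ | ⟨h1, h2⟩
  · exact ⟨⟨N, h1⟩, M, h2⟩
  · exact ⟨⟨M, h1⟩, N, h2⟩

end Step

/-! ### Invariants -/

/-- The bookkeeping of a configuration after `k` rounds. -/
def Regular (k : ℕ) : Config I.G → Prop
  | .returned _ _ => True
  | .running t T wbar => t = k + 1 ∧ ∑ e, T e = k ∧ (∀ e, ¬ I.IsActive e → T e = 0) ∧
      ∀ e, T e = 0 → wbar e = 0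

variable (S : AlmostUniformSampler) (O : MWMC I.G) (A : ArgMax I.G) (δ ε : ℝ)

theorem regular_update {k t : ℕ} {T : Edge I.G → ℕ} {wbar : Edge I.G → ℝ} {z : Edge I.G} {x : ℝ}
    (hz : I.IsActive z) (h : I.Regular k (.running t T wbar)) :
    I.Regular (k + 1) (.running (t + 1) (Function.update T z (T z + 1))
      (Function.update wbar z x)) := by
  obtain ⟨rfl, hsum, hinact, hzero⟩ := h
  refine ⟨rfl, ?_, fun e he => ?_, fun e he => ?_⟩
  · rw [Finset.sum_update_of_mem (Finset.mem_univ z), ← hsum,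
      ← Finset.add_sum_erase _ T (Finset.mem_univ z), Finset.sdiff_singleton_eq_erase]
    ring
  · have hne : e ≠ z := by rintro rfl; exact he hz
    rw [Function.update_of_ne hne]
    exact hinact e he
  · rcases eq_or_ne e z with rfl | hne
    · simp at he
    · rw [Function.update_of_ne hne] at he ⊢
      exact hzero e he

theorem regular_of_mem_support (hε : 0 ≤ ε) (k : ℕ) {s : Config I.G}
    (hs : s ∈ (I.configLaw S O A δ ε k).support) : I.Regular k s := by
  induction k generalizing s with
  | zero =>
    rw [configLaw, PMF.mem_support_pure_iff] at hs
    subst hs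
    simp [Regular]
  | succ k ih =>
    rw [configLaw, PMF.mem_support_bind_iff] at hs
    obtain ⟨s₀, hs₀, hs⟩ := hs
    have h := ih hs₀
    cases s₀ with
    | returned out m =>
      have : s = .returned out m := by simpa [step] using hs
      subst this
      trivial
    | running t T wbar =>
      obtain ⟨M, N, -, -, ⟨-, rfl⟩ | ⟨-, z, hz, -, x, rfl⟩⟩ := I.mem_support_step_running hε hs
      · trivial
      · exact I.regular_update (I.isActive_of_mem_diff hz) h

/-- The bound on the number of duels that the analysis of the rounds yields. -/
def SampleBound (Mstar : MaxMatching I.G) (k : ℕ) : Prop :=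
  (k : ℝ) ≤ ∑ e ∈ I.activeEdges, (1 + 18 * I.hardnessTerm Mstar ε e * I.logTerm δ (k + 1))

/-- The configurations that can be reached while all confidence events hold. -/
def Good (Mstar : MaxMatching I.G) (k : ℕ) : Config I.G → Prop
  | .returned out m => I.borda Mstar - ε ≤ I.borda out ∧ I.SampleBound δ ε Mstar m
  | .running t T wbar => I.Regular k (.running t T wbar) ∧
      (∀ e, I.IsActive e → (T e : ℝ) ≤ 1 + 18 * I.hardnessTerm Mstar ε e * I.logTerm δ t) ∧
      I.Confident δ ε t T wbar

/-- The running configurations at which the confidence event fails. -/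
def Unconfident : Config I.G → Prop
  | .returned _ _ => False
  | .running t T wbar => ¬ I.Confident δ ε t T wbar

theorem sampleBound_of_pulls_le {Mstar : MaxMatching I.G} {k t : ℕ} {T : Edge I.G → ℕ}
    {wbar : Edge I.G → ℝ} (h : I.Regular k (.running t T wbar))
    (hT : ∀ e, I.IsActive e → (T e : ℝ) ≤ 1 + 18 * I.hardnessTerm Mstar ε e * I.logTerm δ t) :
    I.SampleBound δ ε Mstar k := by
  obtain ⟨rfl, hsum, hinact, -⟩ := h
  have h1 : ∑ e ∈ I.activeEdges, T e = k := by
    rw [← hsum]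
    exact Finset.sum_subset (Finset.subset_univ _) fun e _ he =>
      hinact e fun h => he (I.mem_activeEdges.2 h)
  have h2 : (k : ℝ) = ∑ e ∈ I.activeEdges, (T e : ℝ) := by rw [← h1, Nat.cast_sum]
  rw [SampleBound, h2]
  exact Finset.sum_le_sum fun e he => hT e (I.mem_activeEdges.1 he)

variable {S O A δ ε}

/-- The pull bound survives a round: the count of the played edge was at most `18 * hardnessTerm *
logTerm` before, whence the extra `1`, and the logarithm grows with the round for the other edges.
-/
theorem good_or_unconfident_of_mem_support_step {Mstar : MaxMatching I.G}
    (hw : I.IsBordaWinner Mstar) (hδ : 0 < δ) (hδ1 : δ < 1) (hε : 0 < ε) (hε1 : ε ≤ 1) {k : ℕ}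
    {s s' : Config I.G} (hs : I.Good δ ε Mstar k s) (hs' : s' ∈ (I.step S O A δ ε s).support) :
    I.Good δ ε Mstar (k + 1) s' ∨ I.Unconfident δ ε s' := by
  cases s with
  | returned out m =>
    have : s' = .returned out m := by simpa [step] using hs'
    subst this
    exact Or.inl hs
  | running t T wbar =>
    obtain ⟨hreg, hT, hconf⟩ := hs
    obtain ⟨M, N, hM, hN, ⟨hhalt, rfl⟩ | ⟨hhalt, z, hz, hmax, x, rfl⟩⟩ :=
      I.mem_support_step_running hε.le hs'
    · refine Or.inl ⟨I.borda_sub_le_of_halt hconf hε hN hhalt Mstar, ?_⟩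
      rw [hreg.2.1]
      exact I.sampleBound_of_pulls_le δ ε hreg hT
    · by_cases hc : I.Confident δ ε (t + 1) (Function.update T z (T z + 1))
          (Function.update wbar z x)
      · have hact := I.isActive_of_mem_diff hz
        have ht : 1 ≤ t := by rw [hreg.1]; omega
        refine Or.inl ⟨I.regular_update hact hreg, fun e he => ?_, hc⟩
        have hmono := I.logTerm_mono hδ (by linarith [I.one_le_numDuels he]) ht t.le_succ
        have hh := I.one_le_hardnessTerm hw hε hε1 he
        have hle : 18 * I.hardnessTerm Mstar ε e * I.logTerm δ t ≤
            18 * I.hardnessTerm Mstar ε e * I.logTerm δ (t + 1) := by gcongr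
        rcases eq_or_ne e z with rfl | hne
        · have := I.pulls_le_of_pulled hw hδ hδ1 hε ht hconf hM hN hhalt hz hact hmax
          rw [Function.update_self]
          push_cast
          linarith
        · rw [Function.update_of_ne hne]
          linarith [hT e he]
      · exact Or.inr hc

/-! ### Probability of the failure of a confidence event -/

variable (S O A)

theorem unconfident_le (hδ : 0 < δ) (hε : 0 < ε) (k : ℕ) :
    (I.configLaw S O A δ ε k).toOuterMeasure {s | I.Unconfident δ ε s} ≤
      ENNReal.ofReal (k * (δ / ((k : ℝ) + 1) ^ 3)) := by
  set p := I.configLaw S O A δ ε k with hp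
  set b : ℝ := 4 * numDuels I.G * ((k : ℝ) + 1) ^ 3 / δ with hb
  let E : Edge I.G → ℕ → Set (Config I.G) := fun e m => {s | ∃ t T wbar,
    s = .running t T wbar ∧ T e = m ∧
      √(I.logTerm δ (k + 1) / (2 * m)) ≤ |wbar e - I.winProb S (ε / 8) e|}
  -- The pull count of an edge is random, so the union runs over all its possible values. The
  -- invariants hold only on the support.
  have hsub : {s | I.Unconfident δ ε s} ∩ p.support ⊆
      ⋃ e ∈ I.activeEdges, ⋃ m ∈ Finset.Icc 1 k, E e m := by
    rintro s ⟨hs, hsupp⟩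
    have hreg := I.regular_of_mem_support S O A δ ε hε.le k hsupp
    cases s with
    | returned out m => exact hs.elim
    | running t T wbar =>
      obtain ⟨rfl, hsum, hinact, hzero⟩ := hreg
      have hs : ¬ I.Confident δ ε (k + 1) T wbar := hs
      simp only [Confident, not_forall, not_le] at hs
      obtain ⟨e, he, hdev⟩ := hs
      -- An unplayed edge never fails: its estimate is `0`, its radius is `1`, and its reward lies
      -- in `[0, 1]`.
      have hT0 : T e ≠ 0 := by
        intro h0
        rw [radius, if_pos h0, Real.sqrt_one, hzero e h0, zero_sub, abs_neg,
          abs_of_nonneg (I.edgeReward_nonneg e)] at hdev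
        linarith [I.edgeReward_le_one e]
      have hTk : T e ≤ k := hsum ▸ Finset.single_le_sum (f := T) (fun _ _ => Nat.zero_le _)
        (Finset.mem_univ e)
      simp only [Set.mem_iUnion]
      refine ⟨e, I.mem_activeEdges.2 he, T e, Finset.mem_Icc.2 ⟨by omega, hTk⟩, k + 1, T, wbar,
        rfl, rfl, ?_⟩
      rw [radius, if_neg hT0, ← logTerm] at hdev
      have h1 := I.abs_winProb_sub_le S (η := ε / 8) (by positivity) e
      have h2 := abs_sub_le (wbar e) (I.winProb S (ε / 8) e) (I.edgeReward e)
      linarith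
  have hterm : ∀ e ∈ I.activeEdges, ∀ m ∈ Finset.Icc 1 k,
      p.toOuterMeasure (E e m) ≤ ENNReal.ofReal (2 * (1 / b)) := by
    intro e he m hm
    have hK := I.one_le_numDuels (I.mem_activeEdges.1 he)
    have hbpos : 0 < b := by positivity
    refine I.deviation_le S O A δ ε e k m (Real.sqrt_nonneg _) hbpos ?_
    have hm0 : (m : ℝ) ≠ 0 := by
      have := (Finset.mem_Icc.1 hm).1
      exact_mod_cast (by omega : m ≠ 0)
    have hL : I.logTerm δ (k + 1) = Real.log b := by rw [logTerm, hb]; push_cast; rfl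
    have hexp : I.logTerm δ (k + 1) ≤ 2 * √(I.logTerm δ (k + 1) / (2 * m)) ^ 2 * m := by
      have h1 : I.logTerm δ (k + 1) / (2 * m) ≤ √(I.logTerm δ (k + 1) / (2 * m)) ^ 2 := by
        -- No upper bound on `δ` is available here, so the logarithm may be negative; the square
        -- root is then `0`.
        rcases le_total 0 (I.logTerm δ (k + 1) / (2 * m)) with h | h
        · rw [Real.sq_sqrt h]
        · exact h.trans (sq_nonneg _)
      calc I.logTerm δ (k + 1) = 2 * (I.logTerm δ (k + 1) / (2 * m)) * m := by field_simp
        _ ≤ _ := by gcongr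
    calc b = Real.exp (I.logTerm δ (k + 1)) := by rw [hL, Real.exp_log hbpos]
      _ ≤ _ := Real.exp_le_exp.2 hexp
  calc _ ≤ p.toOuterMeasure (⋃ e ∈ I.activeEdges, ⋃ m ∈ Finset.Icc 1 k, E e m) :=
        p.toOuterMeasure_mono hsub
    _ ≤ ∑ e ∈ I.activeEdges, p.toOuterMeasure (⋃ m ∈ Finset.Icc 1 k, E e m) :=
        MeasureTheory.measure_biUnion_finset_le _ _
    _ ≤ ∑ e ∈ I.activeEdges, ∑ m ∈ Finset.Icc 1 k, p.toOuterMeasure (E e m) :=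
        Finset.sum_le_sum fun e _ => MeasureTheory.measure_biUnion_finset_le _ _
    _ ≤ ∑ e ∈ I.activeEdges, ∑ m ∈ Finset.Icc 1 k, ENNReal.ofReal (2 * (1 / b)) :=
        Finset.sum_le_sum fun e he => Finset.sum_le_sum fun m hm => hterm e he m hm
    _ = ENNReal.ofReal (I.activeEdges.card * (k * (2 * (1 / b)))) := by
        rw [Finset.sum_const, Finset.sum_const, Nat.card_Icc, Nat.add_sub_cancel, nsmul_eq_mul,
          nsmul_eq_mul, ENNReal.ofReal_mul (Nat.cast_nonneg _),
          ENNReal.ofReal_mul (Nat.cast_nonneg _), ENNReal.ofReal_natCast, ENNReal.ofReal_natCast]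
    _ ≤ _ := by
        apply ENNReal.ofReal_le_ofReal
        rcases I.activeEdges.eq_empty_or_nonempty with h | ⟨e, he⟩
        · rw [h]; simp; positivity
        · have hK := I.one_le_numDuels (I.mem_activeEdges.1 he)
          have hcard := I.card_activeEdges_le
          -- Bounding the active edges by `2 * numDuels` cancels the `numDuels` in `b`.
          calc _ ≤ (2 * numDuels I.G) * (k * (2 * (1 / b))) := by
                have : 0 ≤ b := by positivity
                gcongr
            _ = _ := by rw [hb]; field_simp; norm_num; ring

/-- A configuration that is not good comes from one that was not good a round earlier, or its own
confidence event fails. The failure probabilities are dominated by the telescoping terms `δ / ((k +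
1) * (k + 2))`. -/
theorem not_good_le {Mstar : MaxMatching I.G} (hw : I.IsBordaWinner Mstar) (hδ : 0 < δ)
    (hδ1 : δ < 1) (hε : 0 < ε) (hε1 : ε ≤ 1) (k : ℕ) :
    (I.configLaw S O A δ ε k).toOuterMeasure {s | ¬ I.Good δ ε Mstar k s} ≤
      ENNReal.ofReal (δ * (1 - 1 / ((k : ℝ) + 1))) := by
  induction k with
  | zero =>
    have hgood : I.Good δ ε Mstar 0 (.running 1 (fun _ => 0) fun _ => 0) := by
      refine ⟨by simp [Regular], fun e he => ?_, fun e _ => ?_⟩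
      · have h1 := I.one_le_hardnessTerm hw hε hε1 he
        have h2 := I.one_le_logTerm hδ hδ1 (I.one_le_numDuels he) le_rfl
        rw [Nat.cast_zero]
        positivity
      · rw [radius, if_pos rfl, Real.sqrt_one, zero_sub, abs_neg,
          abs_of_nonneg (I.edgeReward_nonneg e)]
        linarith [I.edgeReward_le_one e]
    rw [configLaw, PMF.toOuterMeasure_pure_apply, if_neg (by simpa using hgood)]
    exact zero_le
  | succ k ih =>
    have hsub : {s | ¬ I.Good δ ε Mstar (k + 1) s} ⊆
        {s | ¬ (I.Good δ ε Mstar (k + 1) s ∨ I.Unconfident δ ε s)} ∪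
          {s | I.Unconfident δ ε s} := by
      intro s hs
      by_cases h : I.Unconfident δ ε s
      · exact Or.inr h
      · exact Or.inl (by rintro (h' | h'); exacts [hs h', h h'])
    have hstep : (I.configLaw S O A δ ε (k + 1)).toOuterMeasure
        {s | ¬ (I.Good δ ε Mstar (k + 1) s ∨ I.Unconfident δ ε s)} ≤
        (I.configLaw S O A δ ε k).toOuterMeasure {s | ¬ I.Good δ ε Mstar k s} := by
      rw [configLaw, PMF.toOuterMeasure_bind_apply, PMF.toOuterMeasure_apply]
      refine ENNReal.tsum_le_tsum fun s => ?_
      by_cases hs : I.Good δ ε Mstar k s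
      · have h0 : (I.step S O A δ ε s).toOuterMeasure
            {s | ¬ (I.Good δ ε Mstar (k + 1) s ∨ I.Unconfident δ ε s)} = 0 := by
          rw [PMF.toOuterMeasure_apply_eq_zero_iff, Set.disjoint_left]
          exact fun s' hs' hn =>
            hn (I.good_or_unconfident_of_mem_support_step hw hδ hδ1 hε hε1 hs hs')
        rw [h0, mul_zero]
        exact zero_le
      · rw [Set.indicator_of_mem (by exact hs)]
        refine mul_le_of_le_one_right zero_le ?_
        refine (MeasureTheory.measure_mono (Set.subset_univ _)).trans_eq
          (b := (I.step S O A δ ε s).toOuterMeasure Set.univ) ?_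
        rw [PMF.toOuterMeasure_apply_eq_one_iff]
        exact Set.subset_univ _
    refine (MeasureTheory.measure_mono hsub).trans ((MeasureTheory.measure_union_le _ _).trans
      ((add_le_add (hstep.trans ih) (I.unconfident_le S O A hδ hε (k + 1))).trans ?_))
    have hk : (0 : ℝ) ≤ k := Nat.cast_nonneg k
    rw [← ENNReal.ofReal_add (mul_nonneg hδ.le (by
      rw [sub_nonneg, div_le_one (by positivity)]; linarith)) (by positivity)]
    apply ENNReal.ofReal_le_ofReal
    push_cast
    have hdiff : δ * (1 - 1 / ((k : ℝ) + 1 + 1)) - δ * (1 - 1 / ((k : ℝ) + 1)) =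
        δ * (1 / ((k + 1) * (k + 1 + 1))) := by
      field_simp
      ring
    have hle : ((k : ℝ) + 1) * (δ / (k + 1 + 1) ^ 3) ≤ δ * (1 / ((k + 1) * (k + 1 + 1))) := by
      rw [mul_div_assoc', mul_one_div, div_le_div_iff₀ (by positivity) (by positivity)]
      have : 0 ≤ δ * (k + 1 + 1) * (((k : ℝ) + 1 + 1) ^ 2 - (k + 1) ^ 2) :=
        mul_nonneg (by positivity) (by nlinarith)
      nlinarith
    linarith

theorem one_sub_le_good {Mstar : MaxMatching I.G} (hw : I.IsBordaWinner Mstar) (hδ : 0 < δ)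
    (hδ1 : δ < 1) (hε : 0 < ε) (hε1 : ε ≤ 1) (k : ℕ) :
    ENNReal.ofReal (1 - δ) ≤
      (I.configLaw S O A δ ε k).toOuterMeasure {s | I.Good δ ε Mstar k s} := by
  set p := I.configLaw S O A δ ε k with hp
  have h1 : p.toOuterMeasure Set.univ = 1 := by
    rw [PMF.toOuterMeasure_apply_eq_one_iff]
    exact Set.subset_univ _
  have h2 := MeasureTheory.measure_union_le (μ := p.toOuterMeasure)
    {s | I.Good δ ε Mstar k s} {s | ¬ I.Good δ ε Mstar k s}
  have h3 : {s | I.Good δ ε Mstar k s} ∪ {s | ¬ I.Good δ ε Mstar k s} = Set.univ :=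
    Set.union_compl_self _
  rw [h3, h1] at h2
  rw [ENNReal.ofReal_sub _ hδ.le, ENNReal.ofReal_one, tsub_le_iff_right]
  refine h2.trans (add_le_add le_rfl ((I.not_good_le S O A hw hδ hδ1 hε hε1 k).trans ?_))
  apply ENNReal.ofReal_le_ofReal
  have : 0 ≤ 1 / ((k : ℝ) + 1) := by positivity
  nlinarith

end Instance

/-! ### Solving the implicit bound on the number of duels -/

theorem log_le_of_le_pow {a H δ : ℝ} (m : ℕ) (ha : 0 < a) (hm : a ≤ (H / δ) ^ m) :
    Real.log a ≤ m * Real.log (H / δ) := by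
  rw [← Real.log_pow]
  exact Real.log_le_log ha hm

/-- The term `57 * H * log x` is absorbed by the tangent of the logarithm at `114 * H`, whose slope
turns it into `x / 2` plus a multiple of `H * log (H / δ)`. The factor `912` is `2 * 57 * 8`. -/
theorem le_of_le_mul_log {x H κ δ : ℝ} (hx : 1 ≤ x) (hH : 2 ≤ H) (hκ : 4 ≤ κ / δ)
    (hδ : 0 < δ) (hδ1 : δ < 1) (h : x - 1 ≤ 19 * H * Real.log (κ * x ^ 3 / δ)) :
    x ≤ 40 * (H * Real.log (κ / δ)) + 912 * (H * Real.log (H / δ)) := by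
  have hlogκ : 1 ≤ Real.log (κ / δ) := by
    rw [Real.le_log_iff_exp_le (by linarith)]
    linarith [Real.exp_one_lt_d9]
  have hsplit : Real.log (κ * x ^ 3 / δ) = Real.log (κ / δ) + 3 * Real.log x := by
    rw [mul_div_right_comm, Real.log_mul (by linarith) (by positivity), Real.log_pow]
    norm_num
  have hlogx : Real.log x ≤ Real.log (114 * H) + x / (114 * H) - 1 := by
    have h1 := Real.log_le_sub_one_of_pos (x := x / (114 * H)) (by positivity)
    rw [Real.log_div (by linarith) (by positivity)] at h1
    linarith
  have hHx : 57 * H * Real.log x ≤ 57 * H * Real.log (114 * H) + x / 2 - 57 * H := by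
    have h1 : 57 * H * Real.log x ≤ 57 * H * (Real.log (114 * H) + x / (114 * H) - 1) := by gcongr
    have h2 : 57 * H * (x / (114 * H)) = x / 2 := by field_simp; norm_num
    linarith
  have hlogA : Real.log (114 * H) ≤ 8 * Real.log (H / δ) := by
    refine log_le_of_le_pow 8 (by positivity) ?_
    calc 114 * H ≤ 2 ^ 7 * H := by linarith
      _ ≤ H ^ 7 * H := by gcongr
      _ = H ^ 8 := by ring
      _ ≤ (H / δ) ^ 8 := by
        gcongr
        exact le_div_self (by linarith) hδ hδ1.le
  have h1 : 57 * H * Real.log (114 * H) ≤ 57 * H * (8 * Real.log (H / δ)) := by gcongr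
  rw [hsplit] at h
  have h2 : H * 1 ≤ H * Real.log (κ / δ) := by gcongr
  nlinarith

theorem le_of_le_mul_log_of_sq_le {x H κ δ : ℝ} (hx : 1 ≤ x) (hH : 2 ≤ H) (hκ : 4 ≤ κ / δ)
    (hκH : κ ≤ 2 * H ^ 2) (hδ : 0 < δ) (hδ1 : δ < 1)
    (h : x - 1 ≤ 19 * H * Real.log (κ * x ^ 3 / δ)) :
    x ≤ 1112 * (H * Real.log (H / δ)) := by
  have hHδ : H ≤ H / δ := le_div_self (by linarith) hδ hδ1.le
  have h0 : 0 ≤ Real.log (H / δ) := Real.log_nonneg (by linarith)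
  have h1 : Real.log (κ / δ) ≤ 3 * Real.log (H / δ) := by
    refine log_le_of_le_pow 3 (by linarith) ?_
    calc κ / δ ≤ H * H ^ 2 / δ := by gcongr; nlinarith [sq_nonneg H]
      _ = H ^ 2 * (H / δ) := by ring
      _ ≤ (H / δ) ^ 2 * (H / δ) := by gcongr
      _ = _ := by ring
  have h2 := le_of_le_mul_log hx hH hκ hδ hδ1 h
  have h3 : H * Real.log (κ / δ) ≤ H * (3 * Real.log (H / δ)) := by gcongr
  nlinarith [mul_nonneg (by linarith : 0 ≤ H) h0]

theorem le_of_le_mul_log_add {x H κ δ m : ℝ} (hx : 1 ≤ x) (hH : 2 ≤ H) (hκ : 4 ≤ κ / δ)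
    (hm : 0 < m) (hκm : κ ≤ 2 * m ^ 2) (hδ : 0 < δ) (hδ1 : δ < 1)
    (h : x - 1 ≤ 19 * H * Real.log (κ * x ^ 3 / δ)) :
    x ≤ 1112 * (H * Real.log (H / δ) + m) := by
  have hHδ : H ≤ H / δ := le_div_self (by linarith) hδ hδ1.le
  have h0 : 0 ≤ Real.log (H / δ) := Real.log_nonneg (by linarith)
  have h2 := le_of_le_mul_log hx hH hκ hδ hδ1 h
  have hHL : 0 ≤ H * Real.log (H / δ) := mul_nonneg (by linarith) h0
  -- If `m ≤ H ^ 2`, then `κ / δ` is at most a fifth power of `H / δ`, which gives the constant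
  -- `1112 = 40 * 5 + 912`. Otherwise `H ≤ √m`, and since `log (m ^ 2) ≤ 4 * √m` the excess `H * √m`
  -- is at most `m`: this is where the additive `m` comes from.
  rcases le_total m (H ^ 2) with hmH | hmH
  · have h1 : Real.log (κ / δ) ≤ 5 * Real.log (H / δ) := by
      refine log_le_of_le_pow 5 (by linarith) ?_
      calc κ / δ ≤ 2 * (H ^ 2) ^ 2 / δ := by
            gcongr
            exact hκm.trans (by gcongr)
        _ ≤ H * (H ^ 2) ^ 2 / δ := by gcongr
        _ = H ^ 4 * (H / δ) := by ring
        _ ≤ (H / δ) ^ 4 * (H / δ) := by gcongr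
        _ = _ := by ring
    have h3 : H * Real.log (κ / δ) ≤ H * (5 * Real.log (H / δ)) := by gcongr
    nlinarith
  · have h1 : Real.log (κ / δ) ≤ Real.log (H / δ) + 4 * √m := by
      have hs : Real.log (m ^ 2) ≤ 4 * √m := by
        have h4 := Real.log_le_sub_one_of_pos (Real.sqrt_pos.2 hm)
        rw [Real.log_sqrt hm.le] at h4
        rw [Real.log_pow]
        push_cast
        linarith
      calc Real.log (κ / δ) ≤ Real.log (H / δ * m ^ 2) := by
            apply Real.log_le_log (by linarith)
            rw [div_mul_eq_mul_div]
            gcongr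
            exact hκm.trans (by gcongr)
        _ = Real.log (H / δ) + Real.log (m ^ 2) := Real.log_mul (by linarith) (by positivity)
        _ ≤ _ := by linarith
    have h3 : H * Real.log (κ / δ) ≤ H * (Real.log (H / δ) + 4 * √m) := by gcongr
    have h4 : H * √m ≤ m := by
      calc H * √m ≤ √m * √m := by
            gcongr
            exact Real.le_sqrt_of_sq_le hmH
        _ = m := Real.mul_self_sqrt hm.le
    nlinarith

namespace Instance

variable {n ℓ : ℕ} (I : Instance n ℓ)

theorem SampleBound.le {Mstar : MaxMatching I.G} (hw : I.IsBordaWinner Mstar) {δ ε : ℝ}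
    (hδ : 0 < δ) (hδ1 : δ < 1) (hε : 0 < ε) (hε1 : ε ≤ 1) {k : ℕ}
    (h : I.SampleBound δ ε Mstar k) :
    (k : ℝ) ≤ 1112 * (I.hardness Mstar ε * Real.log (I.hardness Mstar ε / δ) +
        (Fintype.card (Edge I.G) : ℝ)) ∧
      ((∀ e : Edge I.G, ∃ M : MaxMatching I.G, e ∈ M.1) →
        (k : ℝ) ≤ 1112 * (I.hardness Mstar ε * Real.log (I.hardness Mstar ε / δ))) := by
  rw [SampleBound] at h
  rcases I.activeEdges.eq_empty_or_nonempty with hempty | ⟨e, he⟩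
  · have hH : I.hardness Mstar ε = 0 := by rw [I.hardness_eq, hempty, Finset.sum_empty]
    rw [hempty, Finset.sum_empty] at h
    rw [hH]
    simp only [zero_mul, zero_add, mul_zero]
    exact ⟨h.trans (by positivity), fun _ => h⟩
  · have hact := I.mem_activeEdges.1 he
    have hK := I.one_le_numDuels hact
    have hL := I.one_le_logTerm hδ hδ1 hK (t := k + 1) (by omega)
    have hcard2 : (2 : ℝ) ≤ I.activeEdges.card := by
      exact_mod_cast I.two_le_card_activeEdges he
    have hcardH := I.card_activeEdges_le_hardness hw hε hε1
    rw [Finset.sum_add_distrib, ← Finset.sum_mul, ← Finset.mul_sum, ← I.hardness_eq,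
      Finset.sum_const, nsmul_eq_mul, mul_one] at h
    set H := I.hardness Mstar ε with hH
    have hx : (1 : ℝ) ≤ (k : ℝ) + 1 := by
      have : (0 : ℝ) ≤ k := Nat.cast_nonneg k
      linarith
    have hκ : 4 ≤ 4 * numDuels I.G / δ := by
      rw [le_div_iff₀ hδ]; nlinarith
    -- The sum of the ones is the number of active edges, at most `H`, hence at most `H * logTerm`;
    -- this turns `18` into `19`.
    have hmain : (k : ℝ) + 1 - 1 ≤
        19 * H * Real.log (4 * numDuels I.G * ((k : ℝ) + 1) ^ 3 / δ) := by
      have hL' : I.logTerm δ (k + 1) =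
          Real.log (4 * numDuels I.G * ((k : ℝ) + 1) ^ 3 / δ) := by
        rw [logTerm]; push_cast; rfl
      rw [← hL']
      have : H * 1 ≤ H * I.logTerm δ (k + 1) := mul_le_mul_of_nonneg_left hL (by linarith)
      linarith
    have hm : (0 : ℝ) < Fintype.card (Edge I.G) := by
      exact_mod_cast Fintype.card_pos_iff.2 ⟨e⟩
    refine ⟨?_, fun hall => ?_⟩
    · have h1 := I.two_mul_numDuels_le_card_sq
      have := le_of_le_mul_log_add hx (hcard2.trans hcardH) hκ hm (by linarith) hδ hδ1 hmain
      linarith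
    · have h1 := I.two_mul_numDuels_le_card_activeEdges_sq hall
      have h2 : (I.activeEdges.card : ℝ) ^ 2 ≤ H ^ 2 := by gcongr
      have := le_of_le_mul_log_of_sq_le hx (hcard2.trans hcardH) hκ (by linarith) hδ hδ1 hmain
      linarith

end Instance

end BordaDuel

theorem theorem1 :
    ∃ C : ℝ, 0 < C ∧
      ∀ (n ℓ : ℕ) (I : BordaDuel.Instance n ℓ) (Mstar : BordaDuel.MaxMatching I.G),
        I.IsBordaWinner Mstar →
      ∀ (S : BordaDuel.AlmostUniformSampler) (O : BordaDuel.MWMC I.G) (A : BordaDuel.ArgMax I.G)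
        (δ ε : ℝ), 0 < δ → δ < 1 → 0 < ε → ε ≤ 1 →
        ENNReal.ofReal (1 - δ) ≤ I.haltProb S O A δ ε fun out samples =>
          I.borda Mstar - ε ≤ I.borda out ∧
          (samples : ℝ) ≤ C * (I.hardness Mstar ε * Real.log (I.hardness Mstar ε / δ) +
            (Fintype.card (BordaDuel.Edge I.G) : ℝ)) ∧
          ((∀ e : BordaDuel.Edge I.G, ∃ M : BordaDuel.MaxMatching I.G, e ∈ M.1) →
            (samples : ℝ) ≤
              C * (I.hardness Mstar ε * Real.log (I.hardness Mstar ε / δ))) := by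
  refine ⟨1112, by norm_num, fun n ℓ I Mstar hw S O A δ ε hδ hδ1 hε hε1 => ?_⟩
  -- A configuration still running after `k` rounds has made `k` duels. Taking `k` beyond the bound
  -- excludes this for good configurations, so all good mass at `k` has halted.
  obtain ⟨k, hk⟩ := exists_nat_gt (1112 * (I.hardness Mstar ε *
    Real.log (I.hardness Mstar ε / δ) + (Fintype.card (BordaDuel.Edge I.G) : ℝ)))
  refine (I.one_sub_le_good S O A hw hδ hδ1 hε hε1 k).trans ?_
  refine le_trans (MeasureTheory.measure_mono fun s hs => ?_)
    (le_iSup (fun k => (I.configLaw S O A δ ε k).toOuterMeasure _) k)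
  cases s with
  | returned out m =>
    exact ⟨out, m, rfl, hs.1,
      BordaDuel.Instance.SampleBound.le I hw hδ hδ1 hε hε1 hs.2⟩
  | running t T wbar =>
    obtain ⟨hreg, hT, -⟩ := hs
    have h := BordaDuel.Instance.SampleBound.le I hw hδ hδ1 hε hε1
      (I.sampleBound_of_pulls_le δ ε hreg hT)
    exact absurd h.1 (not_le.2 hk)
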